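/- All Hilbert spaces are complex and separable. For a Hilbert space $\mathcal{E}$ let $H^2_{\mathcal{E}}(\mathbb{D})$ be the Hilbert space of all analytic functions $f(z)=\sum_{n\ge 0} a_n z^n$ on the open unit disc $\mathbb{D}$, $a_n\in\mathcal{E}$, with $\|f\|^2=\sum_{n\ge 0}\|a_n\|^2<\infty$. Let $H^\infty_{\mathscr{B}(\mathcal{E})}(\mathbb{D})$ be the set of bounded analytic functions $\Phi:\mathbb{D}\to\mathscr{B}(\mathcal{E})$, with $\|\Phi\|_\infty=\sup_{z\in\mathbb{D}}\|\Phi(z)\|$. For $z$ in the unit circle $\mathbb{T}$, $\Phi(z)$ denotes the radial limit $\lim_{r\to1^-}\Phi(rz)$ in the strong operator topology, and "a.e." refers to Lebesgue measure on $\mathbb{T}$. The analytic Toeplitz operator $M_\Phi$ on $H^2_{\mathcal{E}}(\mathbb{D})$ is defined by $(M_\Phi f)(z)=\Phi(z)f(z)$, $z\in\mathbb{D}$. A bounded operator $T$ attains its norm if $\|Tf\|=\|T\|\,\|f\|$ for some $f\neq0$. A function $\Theta \in H^\infty_{\mathscr{B}(\mathcal{E})}(\mathbb{D})$ is inner if $\Theta(z)$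 exists and is an isometry for a.e. $z\in\mathbb{T}$. Theorem. Let $\Phi\in H^\infty_{\mathscr{B}(\mathcal{E})}(\mathbb{D})$. (i) If $M_\Phi$ attains its norm, then for a.e. $z\in\mathbb{T}$ the radial limit $\Phi(z)$ exists and $\|\Phi(z)\|=\|\Phi\|_\infty$. (ii) If $\mathcal{E}=\mathbb{C}$ and $\Phi\neq0$, then $M_\Phi$ attains its norm if and only if $\frac{1}{\|\Phi\|_\infty}\Phi$ is inner. (Here $\mathscr{B}(\mathbb{C})$ is identified with $\mathbb{C}$, so that a bounded analytic scalar function is inner exactly when its radial limits have modulus $1$ a.e.) -/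

import Mathlib

open MeasureTheory Filter Topology AddCircle
open scoped Complex.UnitDisc ENNReal

namespace HardyToeplitz

noncomputable section

instance : Fact (0 < 2 * Real.pi) := ⟨Real.two_pi_pos⟩

/-- The normalized Lebesgue measure `m` of the unit circle, parametrized by the angle
`t ∈ ℝ / 2πℤ`; the point of the circle belonging to the angle `t` is `toCircle t = exp (i t)`. -/
abbrev circleMeasure : Measure (AddCircle (2 * Real.pi)) := haarAddCircle

section Parseval

variable {E : Type*} [NormedAddCommGroup E] [InnerProductSpace ℂ E] [CompleteSpace E]

/-- The boundary series of an absolutely summable sequence of coefficients. -/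
def fseries (c : ℕ → E) (t : AddCircle (2 * Real.pi)) : E := ∑' n : ℕ, fourier (n : ℤ) t • c n

theorem norm_fourier_apply (n : ℤ) (t : AddCircle (2 * Real.pi)) : ‖fourier n t‖ = 1 := by
  rw [fourier_apply, Circle.norm_coe]

theorem integral_fourier (n : ℤ) :
    ∫ t, fourier n t ∂circleMeasure = if n = 0 then 1 else 0 := by
  have h := fourierCoeff_fourier (T := 2 * Real.pi) n
  have h0 := congrFun h 0
  simp only [fourierCoeff, neg_zero, fourier_zero, one_smul] at h0
  rw [h0, Pi.single_apply]
  simp [eq_comm]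

theorem hasSum_fseries {c : ℕ → E} (hc : Summable fun n => ‖c n‖) (t : AddCircle (2 * Real.pi)) :
    HasSum (fun n : ℕ => fourier (n : ℤ) t • c n) (fseries c t) := by
  refine (Summable.of_norm ?_).hasSum
  simpa only [norm_smul, norm_fourier_apply, one_mul] using hc

theorem continuous_fseries {c : ℕ → E} (hc : Summable fun n => ‖c n‖) :
    Continuous (fseries c) := by
  refine continuous_tsum (fun n => ?_) hc (fun n t => ?_)
  · exact (map_continuous (fourier (n : ℤ))).smul continuous_const
  · rw [norm_smul, norm_fourier_apply, one_mul]

theorem integrable_of_continuous {F : Type*} [NormedAddCommGroup F]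
    {f : AddCircle (2 * Real.pi) → F} (hf : Continuous f) : Integrable f circleMeasure :=
  hf.integrable_of_hasCompactSupport (HasCompactSupport.of_compactSpace f)

theorem integral_fourier_neg_fseries {c : ℕ → E} (hc : Summable fun n => ‖c n‖) (n : ℕ) :
    ∫ t, fourier (-(n : ℤ)) t • fseries c t ∂circleMeasure = c n := by
  have hterm : ∀ m : ℕ, ∀ t : AddCircle (2 * Real.pi),
      fourier (-(n : ℤ)) t • (fourier (m : ℤ) t • c m) = fourier (-(n : ℤ) + m) t • c m := by
    intro m t
    rw [smul_smul, fourier_add]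
  have hint : ∀ m : ℕ, Integrable (fun t : AddCircle (2 * Real.pi) =>
      fourier (-(n : ℤ) + m) t • c m) circleMeasure := fun m =>
    integrable_of_continuous ((map_continuous (fourier (-(n : ℤ) + m))).smul continuous_const)
  have hs := hasSum_integral_of_summable_integral_norm hint (by
    simpa only [norm_smul, norm_fourier_apply, one_mul, integral_const, probReal_univ,
      one_smul] using hc)
  have hval : ∀ m : ℕ, ∫ t, fourier (-(n : ℤ) + m) t • c m ∂circleMeasure
      = if m = n then c n else 0 := by
    intro m
    rw [integral_smul_const, integral_fourier]
    by_cases h : m = n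
    · subst h; simp
    · have : ¬ (-(n : ℤ) + m = 0) := by omega
      simp [h, this]
  simp only [hval] at hs
  have h1 := hs.unique (hasSum_ite_eq n (c n))
  rw [← h1]
  refine integral_congr_ae (Eventually.of_forall fun t => ?_)
  have h2 := (hasSum_fseries hc t).const_smul (fourier (-(n : ℤ)) t)
  simp only [hterm] at h2
  exact h2.tsum_eq.symm

/-- Parseval's identity for absolutely summable coefficients. -/
theorem hasSum_sq_norm_fseries {c : ℕ → E} (hc : Summable fun n => ‖c n‖) :
    HasSum (fun n => ‖c n‖ ^ 2) (∫ t, ‖fseries c t‖ ^ 2 ∂circleMeasure) := by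
  have hcont := continuous_fseries hc
  obtain ⟨K, hK⟩ : ∃ K, ∀ t, ‖fseries c t‖ ≤ K := by
    obtain ⟨K, hK⟩ := isCompact_univ.exists_bound_of_continuousOn hcont.continuousOn
    exact ⟨K, fun t => hK t trivial⟩
  have hint : ∀ n : ℕ, Integrable (fun t : AddCircle (2 * Real.pi) =>
      inner ℂ (c n) (fourier (-(n : ℤ)) t • fseries c t)) circleMeasure := fun n =>
    integrable_of_continuous
      (continuous_const.inner ((map_continuous (fourier (-(n : ℤ)))).smul hcont))
  have hs := hasSum_integral_of_summable_integral_norm hint (by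
    refine Summable.of_nonneg_of_le (fun n => by positivity) (fun n => ?_) (hc.mul_right K)
    calc ∫ t, ‖inner ℂ (c n) (fourier (-(n : ℤ)) t • fseries c t)‖ ∂circleMeasure
        ≤ ∫ _t, ‖c n‖ * K ∂circleMeasure := by
          refine integral_mono (hint n).norm (integrable_const _) fun t => ?_
          refine (norm_inner_le_norm _ _).trans ?_
          rw [norm_smul, norm_fourier_apply, one_mul]
          exact mul_le_mul_of_nonneg_left (hK t) (norm_nonneg _)
      _ = ‖c n‖ * K := by simp)
  have hval : ∀ n : ℕ, ∫ t, inner ℂ (c n) (fourier (-(n : ℤ)) t • fseries c t) ∂circleMeasure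
      = ((‖c n‖ ^ 2 : ℝ) : ℂ) := by
    intro n
    have hi : Integrable (fun t : AddCircle (2 * Real.pi) =>
        fourier (-(n : ℤ)) t • fseries c t) circleMeasure :=
      integrable_of_continuous ((map_continuous (fourier (-(n : ℤ)))).smul hcont)
    rw [integral_inner hi (c n), integral_fourier_neg_fseries hc,
      inner_self_eq_norm_sq_to_K]
    push_cast; rfl
  simp only [hval] at hs
  have hptw : ∀ t : AddCircle (2 * Real.pi),
      ∑' n : ℕ, inner ℂ (c n) (fourier (-(n : ℤ)) t • fseries c t)
        = ((‖fseries c t‖ ^ 2 : ℝ) : ℂ) := by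
    intro t
    have h1 : HasSum (fun n : ℕ => inner ℂ (fseries c t) (fourier (n : ℤ) t • c n))
        (inner ℂ (fseries c t) (fseries c t)) :=
      (hasSum_fseries hc t).mapL (innerSL ℂ (fseries c t))
    have h2 := (Complex.hasSum_conj' ).2 h1
    rw [inner_conj_symm] at h2
    have h3 : ∀ n : ℕ, (starRingEnd ℂ) (inner ℂ (fseries c t) (fourier (n : ℤ) t • c n))
        = inner ℂ (c n) (fourier (-(n : ℤ)) t • fseries c t) := by
      intro n
      rw [inner_conj_symm, inner_smul_left, inner_smul_right, fourier_neg]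
    simp only [h3] at h2
    rw [h2.tsum_eq, inner_self_eq_norm_sq_to_K]
    push_cast; rfl
  simp only [hptw] at hs
  rw [integral_complex_ofReal] at hs
  exact Complex.hasSum_ofReal.1 hs

end Parseval

section Hardy

variable (E : Type*) [NormedAddCommGroup E] [InnerProductSpace ℂ E]

/-- The vector space of all functions `f` on the unit disc with values in `E` that have a power
series expansion `f z = ∑ aₙ zⁿ` on the disc with `∑ ‖aₙ‖² < ∞`. -/
def hardySubmodule : Submodule ℂ (𝔻 → E) where
  carrier := {f | ∃ a : ℕ → E, Summable (fun n => ‖a n‖ ^ 2) ∧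
    ∀ z : 𝔻, HasSum (fun n => (z : ℂ) ^ n • a n) (f z)}
  add_mem' := by
    rintro f g ⟨a, ha, hf⟩ ⟨b, hb, hg⟩
    refine ⟨a + b, ?_, fun z => ?_⟩
    · refine Summable.of_nonneg_of_le (fun n => by positivity) (fun n => ?_)
        ((ha.add hb).mul_left 2)
      have h := norm_add_le (a n) (b n)
      have h' : ‖a n + b n‖ ^ 2 ≤ (‖a n‖ + ‖b n‖) ^ 2 := by gcongr
      simp only [Pi.add_apply]
      nlinarith [sq_nonneg (‖a n‖ - ‖b n‖)]
    · simpa [smul_add] using (hf z).add (hg z)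
  zero_mem' := ⟨0, by simp, fun z => by simp⟩
  smul_mem' := by
    rintro w f ⟨a, ha, hf⟩
    refine ⟨w • a, ?_, fun z => ?_⟩
    · simpa [norm_smul, mul_pow] using ha.mul_left (‖w‖ ^ 2)
    · simpa [smul_comm w] using (hf z).const_smul w

/-- The `E`-valued Hardy space `H²_E(𝔻)`. It is a type of its own, so that it carries the Hardy
space norm and not the topology of pointwise convergence. -/
def HardySpace : Type _ := hardySubmodule E

instance : AddCommGroup (HardySpace E) := inferInstanceAs (AddCommGroup (hardySubmodule E))

instance : Module ℂ (HardySpace E) := inferInstanceAs (Module ℂ (hardySubmodule E))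

instance : CoeFun (HardySpace E) (fun _ => 𝔻 → E) := ⟨fun f => f.1⟩

variable {E}

theorem summable_mul_pow {b : ℕ → E} {r s : ℝ} (hr : 0 ≤ r) (hrs : r < s)
    (hb : Summable fun n => (s : ℂ) ^ n • b n) : Summable fun n => ‖(r : ℂ) ^ n • b n‖ := by
  have hs : 0 < s := hr.trans_lt hrs
  obtain ⟨K, hK⟩ := hb.tendsto_atTop_zero.norm.bddAbove_range
  have hK' : ∀ n, s ^ n * ‖b n‖ ≤ K := fun n => by
    have := hK (Set.mem_range_self n)
    simpa [norm_smul, abs_of_pos hs] using this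
  refine Summable.of_nonneg_of_le (fun n => norm_nonneg _) (fun n => ?_)
    ((summable_geometric_of_lt_one (div_nonneg hr hs.le)
      ((div_lt_one hs).2 hrs)).mul_right K)
  have h1 : ‖(r : ℂ) ^ n • b n‖ = (r / s) ^ n * (s ^ n * ‖b n‖) := by
    rw [norm_smul, norm_pow, Complex.norm_real, Real.norm_of_nonneg hr, div_pow]
    field_simp
  rw [h1]
  exact mul_le_mul_of_nonneg_left (hK' n) (by positivity)

/-- The point `r ζ` of the disc, for `0 ≤ r < 1` and `ζ` on the circle. -/
def radialPt (r : ℝ) (hr : 0 ≤ r) (hr1 : r < 1) (t : AddCircle (2 * Real.pi)) : 𝔻 :=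
  Complex.UnitDisc.mk ((r : ℂ) * toCircle t) (by
    rw [norm_mul, Circle.norm_coe, Complex.norm_real, Real.norm_of_nonneg hr, mul_one]
    exact hr1)

theorem coe_radialPt (r : ℝ) (hr : 0 ≤ r) (hr1 : r < 1) (t : AddCircle (2 * Real.pi)) :
    (radialPt r hr hr1 t : ℂ) = (r : ℂ) * toCircle t := rfl

theorem summable_radial {b : ℕ → E} {g : 𝔻 → E}
    (hg : ∀ z : 𝔻, HasSum (fun n => (z : ℂ) ^ n • b n) (g z)) {r : ℝ} (hr : 0 ≤ r) (hr1 : r < 1) :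
    Summable fun n => ‖(r : ℂ) ^ n • b n‖ := by
  obtain ⟨s, hrs, hs1⟩ := exists_between hr1
  refine summable_mul_pow hr hrs ?_
  simpa [coe_radialPt] using (hg (radialPt s (hr.trans hrs.le) hs1 0)).summable

theorem fseries_radial {b : ℕ → E} {g : 𝔻 → E}
    (hg : ∀ z : 𝔻, HasSum (fun n => (z : ℂ) ^ n • b n) (g z)) {r : ℝ} (hr : 0 ≤ r) (hr1 : r < 1)
    (t : AddCircle (2 * Real.pi)) :
    fseries (fun n => (r : ℂ) ^ n • b n) t = g (radialPt r hr hr1 t) := by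
  rw [fseries, ← (hg _).tsum_eq]
  refine tsum_congr fun n => ?_
  rw [coe_radialPt, smul_smul, mul_pow, mul_comm, fourier_apply, natCast_zsmul,
    toCircle_nsmul, Circle.coe_pow]

/-- Parseval's identity on the circle of radius `r < 1`. -/
theorem hasSum_sq_radial [CompleteSpace E] {b : ℕ → E} {g : 𝔻 → E}
    (hg : ∀ z : 𝔻, HasSum (fun n => (z : ℂ) ^ n • b n) (g z)) {r : ℝ} (hr : 0 ≤ r) (hr1 : r < 1) :
    HasSum (fun n => ‖(r : ℂ) ^ n • b n‖ ^ 2)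
      (∫ t, ‖g (radialPt r hr hr1 t)‖ ^ 2 ∂circleMeasure) := by
  have hc := summable_radial hg hr hr1
  have h := hasSum_sq_norm_fseries hc
  simpa only [fseries_radial hg hr hr1] using h

theorem continuous_radial [CompleteSpace E] {b : ℕ → E} {g : 𝔻 → E}
    (hg : ∀ z : 𝔻, HasSum (fun n => (z : ℂ) ^ n • b n) (g z)) {r : ℝ} (hr : 0 ≤ r) (hr1 : r < 1) :
    Continuous fun t => g (radialPt r hr hr1 t) := by
  have hc := summable_radial hg hr hr1
  exact (continuous_fseries hc).congr (fseries_radial hg hr hr1)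

/-- If `‖g‖ ≤ C ‖f‖` pointwise on the disc, then the Taylor coefficients `b` of `g` and `a` of `f`
satisfy `∑ ‖bₙ‖² ≤ C² ∑ ‖aₙ‖²`. -/
theorem sum_sq_le_of_norm_le [CompleteSpace E] {a b : ℕ → E} {f g : 𝔻 → E} {C : ℝ}
    (ha : Summable fun n => ‖a n‖ ^ 2)
    (hf : ∀ z : 𝔻, HasSum (fun n => (z : ℂ) ^ n • a n) (f z))
    (hg : ∀ z : 𝔻, HasSum (fun n => (z : ℂ) ^ n • b n) (g z))
    (hle : ∀ z, ‖g z‖ ≤ C * ‖f z‖) (s : Finset ℕ) :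
    ∑ n ∈ s, ‖b n‖ ^ 2 ≤ C ^ 2 * ∑' n, ‖a n‖ ^ 2 := by
  have key : ∀ r : ℝ, 0 ≤ r → r < 1 →
      ∑ n ∈ s, ‖(r : ℂ) ^ n • b n‖ ^ 2 ≤ C ^ 2 * ∑' n, ‖a n‖ ^ 2 := by
    intro r hr hr1
    have hA := hasSum_sq_radial hf hr hr1
    have hB := hasSum_sq_radial hg hr hr1
    calc ∑ n ∈ s, ‖(r : ℂ) ^ n • b n‖ ^ 2
        ≤ ∫ t, ‖g (radialPt r hr hr1 t)‖ ^ 2 ∂circleMeasure :=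
          sum_le_hasSum s (fun n _ => by positivity) hB
      _ ≤ ∫ t, C ^ 2 * ‖f (radialPt r hr hr1 t)‖ ^ 2 ∂circleMeasure := by
          refine integral_mono
            (integrable_of_continuous ((continuous_radial hg hr hr1).norm.pow 2))
            (integrable_of_continuous
              (continuous_const.mul ((continuous_radial hf hr hr1).norm.pow 2))) fun t => ?_
          simp only
          rw [← mul_pow]
          gcongr
          exact hle _
      _ = C ^ 2 * ∑' n, ‖(r : ℂ) ^ n • a n‖ ^ 2 := by
          rw [integral_const_mul, hA.tsum_eq]
      _ ≤ C ^ 2 * ∑' n, ‖a n‖ ^ 2 := by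
          refine mul_le_mul_of_nonneg_left ?_ (sq_nonneg _)
          refine hA.summable.tsum_le_tsum (fun n => ?_) ha
          rw [norm_smul, norm_pow, Complex.norm_real, Real.norm_of_nonneg hr]
          gcongr
          exact mul_le_of_le_one_left (norm_nonneg _) (pow_le_one₀ hr hr1.le)
  have hcont : Continuous fun r : ℝ => ∑ n ∈ s, ‖(r : ℂ) ^ n • b n‖ ^ 2 := by fun_prop
  have hlim : Tendsto (fun r : ℝ => ∑ n ∈ s, ‖(r : ℂ) ^ n • b n‖ ^ 2) (𝓝[<] 1)
      (𝓝 (∑ n ∈ s, ‖b n‖ ^ 2)) := by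
    have := hcont.tendsto 1
    simp only [Complex.ofReal_one, one_pow, one_smul] at this
    exact this.mono_left nhdsWithin_le_nhds
  refine le_of_tendsto hlim ?_
  filter_upwards [Ioo_mem_nhdsLT (show (0 : ℝ) < 1 by norm_num)] with r hr
  exact key r hr.1.le hr.2

/-- The Taylor coefficients of a function on the disc are unique. -/
theorem coeff_unique [CompleteSpace E] {a b : ℕ → E} {f : 𝔻 → E}
    (ha : ∀ z : 𝔻, HasSum (fun n => (z : ℂ) ^ n • a n) (f z))
    (hb : ∀ z : 𝔻, HasSum (fun n => (z : ℂ) ^ n • b n) (f z)) : a = b := by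
  have h0 : ∀ z : 𝔻, HasSum (fun n => (z : ℂ) ^ n • (a - b) n) ((0 : 𝔻 → E) z) := fun z => by
    simpa [smul_sub] using (ha z).sub (hb z)
  have h1 : ∀ z : 𝔻, HasSum (fun n => (z : ℂ) ^ n • (0 : ℕ → E) n) ((0 : 𝔻 → E) z) := fun z => by
    simp
  funext n
  have h := sum_sq_le_of_norm_le (C := 0) (by simp) h1 h0 (by simp) {n}
  have h2 : ‖(a - b) n‖ ^ 2 ≤ 0 := by simpa using h
  have h3 : (a - b) n = 0 := by
    rw [← norm_eq_zero]
    nlinarith [norm_nonneg ((a - b) n)]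
  exact sub_eq_zero.1 h3

/-- The Taylor coefficients `aₙ` of `f = ∑ aₙ zⁿ` in the Hardy space. -/
def coeff (f : HardySpace E) : ℕ → E := f.2.choose

theorem summable_coeff (f : HardySpace E) : Summable fun n => ‖coeff f n‖ ^ 2 :=
  f.2.choose_spec.1

theorem hasSum_coeff (f : HardySpace E) (z : 𝔻) :
    HasSum (fun n => (z : ℂ) ^ n • coeff f n) (f z) :=
  f.2.choose_spec.2 z

variable [CompleteSpace E]

/-- The Taylor coefficients as a linear map to `ℓ²(ℕ, E)`. -/
def coeffₗ : HardySpace E →ₗ[ℂ] lp (fun _ : ℕ => E) 2 where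
  toFun f := ⟨coeff f, memℓp_gen (by simpa using summable_coeff f)⟩
  map_add' f g := by
    ext1
    refine coeff_unique (f := (f + g).1) (hasSum_coeff (f + g)) fun z => ?_
    have h := (hasSum_coeff f z).add (hasSum_coeff g z)
    simp only [← smul_add] at h
    exact h
  map_smul' w f := by
    ext1
    refine coeff_unique (f := (w • f).1) (hasSum_coeff (w • f)) fun z => ?_
    have h := (hasSum_coeff f z).const_smul w
    simp only [smul_comm w] at h
    exact h

theorem coeffₗ_injective : Function.Injective (coeffₗ (E := E)) := by
  intro f g h
  have h' : coeff f = coeff g := congrArg Subtype.val h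
  refine Subtype.ext (funext fun z => ?_)
  have hf := hasSum_coeff f z
  rw [h'] at hf
  exact hf.unique (hasSum_coeff g z)

/-- The norm of `H²_E(𝔻)` is the `ℓ²` norm of the Taylor coefficients. -/
instance : NormedAddCommGroup (HardySpace E) :=
  NormedAddCommGroup.induced _ _ (coeffₗ (E := E)) coeffₗ_injective

instance : NormedSpace ℂ (HardySpace E) :=
  NormedSpace.induced ℂ _ _ (coeffₗ (E := E))

theorem norm_sq_eq (f : HardySpace E) : ‖f‖ ^ 2 = ∑' n, ‖coeff f n‖ ^ 2 := by
  have h := lp.norm_rpow_eq_tsum (p := 2) (by norm_num) (coeffₗ f)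
  simp only [ENNReal.toReal_ofNat, Real.rpow_ofNat] at h
  exact h

end Hardy

section Symbols

variable {E : Type*} [NormedAddCommGroup E] [InnerProductSpace ℂ E]

/-- `Φ` restricts to a bounded analytic function on the open unit disc with values in the bounded
operators on `E`, that is, `Φ ∈ H^∞_{B(E)}(𝔻)`. The values of `Φ` outside the disc play no role. -/
structure IsHInfty (Φ : ℂ → E →L[ℂ] E) : Prop where
  differentiableOn : DifferentiableOn ℂ Φ (Metric.ball 0 1)
  bounded : ∃ C : ℝ, ∀ z ∈ Metric.ball (0 : ℂ) 1, ‖Φ z‖ ≤ C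

/-- The supremum norm `‖Φ‖_∞` over the open unit disc. -/
def hInftyNorm (Φ : ℂ → E →L[ℂ] E) : ℝ := ⨆ z : 𝔻, ‖Φ z‖

/-- `A` is the boundary value of `Φ` at the point `ζ` of the circle: the radial limit
`lim_{r → 1⁻} Φ (r ζ)` in the strong operator topology. -/
def IsRadialLimit (Φ : ℂ → E →L[ℂ] E) (ζ : Circle) (A : E →L[ℂ] E) : Prop :=
  ∀ x : E, Tendsto (fun r : ℝ => Φ ((r : ℂ) * ζ) x) (𝓝[<] 1) (𝓝 (A x))

/-- An inner function: a bounded analytic function on the disc whose boundary values (via radial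
limits) are isometries almost everywhere on the circle. -/
def IsInner (Φ : ℂ → E →L[ℂ] E) : Prop :=
  IsHInfty Φ ∧ ∀ᵐ t ∂circleMeasure, ∃ A : E →L[ℂ] E, IsRadialLimit Φ (toCircle t) A ∧ Isometry A

theorem IsHInfty.norm_le {Φ : ℂ → E →L[ℂ] E} (hΦ : IsHInfty Φ) (z : 𝔻) :
    ‖Φ z‖ ≤ hInftyNorm Φ := by
  obtain ⟨C, hC⟩ := hΦ.bounded
  refine le_ciSup (f := fun z : 𝔻 => ‖Φ z‖) ⟨C, ?_⟩ z
  rintro _ ⟨w, rfl⟩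
  exact hC w (by simpa using w.norm_lt_one)

theorem hInftyNorm_nonneg (Φ : ℂ → E →L[ℂ] E) : 0 ≤ hInftyNorm Φ :=
  Real.iSup_nonneg fun _ => norm_nonneg _

variable [CompleteSpace E]

/-- Every function in the Hardy space is analytic on the disc. -/
theorem differentiableOn_extension (f : HardySpace E) :
    DifferentiableOn ℂ (fun w : ℂ => ∑' n, w ^ n • coeff f n) (Metric.ball 0 1) := by
  intro w hw
  have hw1 : ‖w‖ < 1 := by simpa using hw
  obtain ⟨s, hws, hs1⟩ := exists_between hw1
  have hs0 : 0 ≤ s := (norm_nonneg w).trans hws.le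
  have h := Complex.differentiableOn_tsum_of_summable_norm
    (F := fun (n : ℕ) (w : ℂ) => w ^ n • coeff f n) (U := Metric.ball 0 s)
    (summable_radial (hasSum_coeff f) hs0 hs1)
    (fun n => by fun_prop) Metric.isOpen_ball (fun n v hv => by
      have hv' : ‖v‖ < s := by simpa using hv
      rw [norm_smul, norm_smul, norm_pow, norm_pow, Complex.norm_real, Real.norm_of_nonneg hs0]
      gcongr)
  exact (h.differentiableAt (Metric.isOpen_ball.mem_nhds (by simpa using hws))).differentiableWithinAt

theorem exists_coeff_mul {Φ : ℂ → E →L[ℂ] E} (hΦ : IsHInfty Φ) (f : HardySpace E) :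
    ∃ b : ℕ → E, ∀ z : 𝔻, HasSum (fun n => (z : ℂ) ^ n • b n) (Φ z (f z)) := by
  have hd : DifferentiableOn ℂ (fun w : ℂ => Φ w (∑' n, w ^ n • coeff f n)) (Metric.ball 0 1) :=
    hΦ.differentiableOn.clm_apply (differentiableOn_extension f)
  refine ⟨fun n => ((n.factorial : ℂ)⁻¹) • iteratedDeriv n
    (fun w : ℂ => Φ w (∑' n, w ^ n • coeff f n)) 0, fun z => ?_⟩
  have h := Complex.hasSum_taylorSeries_on_ball hd (z := (z : ℂ)) (by simpa using z.norm_lt_one)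
  simp only [sub_zero] at h
  rw [(hasSum_coeff f z).tsum_eq] at h
  convert h using 2 with n
  rw [smul_comm]

theorem mul_mem {Φ : ℂ → E →L[ℂ] E} (hΦ : IsHInfty Φ) (f : HardySpace E) :
    (fun z : 𝔻 => Φ z (f z)) ∈ hardySubmodule E := by
  obtain ⟨b, hb⟩ := exists_coeff_mul hΦ f
  refine ⟨b, ?_, hb⟩
  refine summable_of_sum_le (fun n => by positivity)
    (sum_sq_le_of_norm_le (C := hInftyNorm Φ) (summable_coeff f) (hasSum_coeff f) hb fun z => ?_)
  exact ((Φ z).le_opNorm _).trans (mul_le_mul_of_nonneg_right (hΦ.norm_le z) (norm_nonneg _))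

/-- The analytic Toeplitz operator (multiplication operator) `M_Φ` on `H²_E(𝔻)`,
`(M_Φ f)(z) = Φ(z) f(z)` for `z` in the disc. -/
def mulOp (Φ : ℂ → E →L[ℂ] E) (hΦ : IsHInfty Φ) : HardySpace E →L[ℂ] HardySpace E :=
  LinearMap.mkContinuous
    { toFun := fun f => ⟨fun z : 𝔻 => Φ z (f z), mul_mem hΦ f⟩
      map_add' := fun f g => Subtype.ext (funext fun z => (Φ z).map_add (f z) (g z))
      map_smul' := fun w f => Subtype.ext (funext fun z => (Φ z).map_smul w (f z)) }
    (hInftyNorm Φ) (fun f => by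
      refine le_of_sq_le_sq ?_ (mul_nonneg (hInftyNorm_nonneg Φ) (norm_nonneg f))
      rw [mul_pow, norm_sq_eq, norm_sq_eq]
      refine (summable_coeff _).tsum_le_of_sum_le
        (sum_sq_le_of_norm_le (summable_coeff f) (hasSum_coeff f) (hasSum_coeff _) fun z => ?_)
      exact ((Φ z).le_opNorm _).trans
        (mul_le_mul_of_nonneg_right (hΦ.norm_le z) (norm_nonneg _)))

theorem mulOp_apply (Φ : ℂ → E →L[ℂ] E) (hΦ : IsHInfty Φ) (f : HardySpace E) (z : 𝔻) :
    mulOp Φ hΦ f z = Φ z (f z) := rfl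

end Symbols

/-- A bounded operator `T` is norm-attaining if `‖T f‖ = ‖T‖ ‖f‖` for some nonzero vector `f`. -/
def NormAttaining {H : Type*} [NormedAddCommGroup H] [NormedSpace ℂ H] (T : H →L[ℂ] H) : Prop :=
  ∃ f : H, f ≠ 0 ∧ ‖T f‖ = ‖T‖ * ‖f‖

end

end HardyToeplitz

namespace HardyToeplitz

noncomputable section

/-! Write `C` for `hInftyNorm Φ`, and let `f*` in `L²(𝕋, E)` be the function whose nonnegative
Fourier coefficients are the Taylor coefficients of `f` and whose negative ones vanish. Then `f ↦
f*` is isometric, and by Fatou's theorem `f*` is almost everywhere the radial limit of `f`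
(`ae_tendsto_radial`). Applied to `M_Φ` of constants from a countable dense set, Fatou's theorem
yields strong radial limits `Φ(ζ)` almost everywhere, and `(M_Φ f)* = Φ f*` almost everywhere.

Testing on Szegő kernels gives `‖M_Φ‖ = C` (`norm_mulOp`). If `f ≠ 0` attains the norm, then
`C²‖f*‖² - ‖Φ f*‖²` is nonnegative with integral zero, hence zero almost everywhere. Since `f*`
vanishes almost nowhere (`ae_boundary_ne_zero`), `‖Φ(ζ)‖ ≥ C` follows, and `≤` is automatic. For
scalars, norm `C` means `C` times an isometry; conversely, if `Φ / C` is inner, the constant `1`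
attains the norm.

Fatou's theorem comes from Poisson integrals at Lebesgue points. The nonvanishing of `f*` comes from
Jensen's formula, which bounds the means of `log |u|` from below for a scalar function `u`. -/

theorem integral_circleMeasure_eq_circleAverage {F : Type*} [NormedAddCommGroup F]
    [NormedSpace ℝ F] (g : ℂ → F) (r : ℝ) :
    ∫ t, g (r * toCircle t) ∂circleMeasure = Real.circleAverage g 0 r := by
  rw [integral_haarAddCircle, Real.circleAverage_def,
    ← AddCircle.intervalIntegral_preimage (2 * Real.pi) 0, zero_add]
  congr 1
  refine intervalIntegral.integral_congr fun θ _ => ?_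
  simp only [toCircle_apply_mk, circleMap, zero_add, Circle.coe_exp]
  congr 4
  have : (2 * Real.pi / (2 * Real.pi) * θ : ℝ) = θ := by field_simp
  rw [this]

theorem integrable_Lp_two {F : Type*} [NormedAddCommGroup F] (g : Lp F 2 circleMeasure) :
    Integrable g circleMeasure :=
  (Lp.memLp g).integrable (by norm_num)

/-! ### Boundary functions in `L²` and their Poisson integrals. -/

section Boundary

variable {E : Type*} [NormedAddCommGroup E] [InnerProductSpace ℂ E]

theorem memLp_fourier_smul (n : ℤ) (x : E) :
    MemLp (fun t : AddCircle (2 * Real.pi) => fourier n t • x) 2 circleMeasure := by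
  refine MemLp.of_bound (C := ‖x‖)
    ((map_continuous (fourier n)).smul continuous_const).aestronglyMeasurable
    (Eventually.of_forall fun t => ?_)
  rw [norm_smul, norm_fourier_apply, one_mul]

theorem inner_toLp_fourier_smul (m n : ℤ) (x y : E) :
    inner ℂ ((memLp_fourier_smul m x).toLp) ((memLp_fourier_smul n y).toLp)
      = if m = n then inner ℂ x y else 0 := by
  rw [L2.inner_def]
  have h : ∀ᵐ t ∂circleMeasure,
      inner ℂ ((memLp_fourier_smul m x).toLp _ t) ((memLp_fourier_smul n y).toLp _ t)
        = fourier (n - m) t * inner ℂ x y := by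
    filter_upwards [(memLp_fourier_smul m x).coeFn_toLp, (memLp_fourier_smul n y).coeFn_toLp]
      with t h1 h2
    rw [h1, h2, inner_smul_left, inner_smul_right, ← fourier_neg, ← mul_assoc, ← fourier_add,
      neg_add_eq_sub]
  rw [integral_congr_ae h, integral_mul_const, integral_fourier]
  simp only [sub_eq_zero, eq_comm (a := n)]
  split_ifs <;> simp

/-- The isometric embedding `x ↦ ζⁿ x` of `E` into `L²(𝕋, E)`. -/
def fourierEmb (n : ℕ) : E →ₗᵢ[ℂ] Lp E 2 circleMeasure where
  toFun x := (memLp_fourier_smul (n : ℤ) x).toLp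
  map_add' x y := by
    rw [← MemLp.toLp_add]
    exact MemLp.toLp_congr _ _ (Eventually.of_forall fun t => by simp)
  map_smul' w x := by
    rw [RingHom.id_apply, ← MemLp.toLp_const_smul]
    exact MemLp.toLp_congr _ _ (Eventually.of_forall fun t => by simp [smul_comm w])
  norm_map' x := by
    have h := inner_toLp_fourier_smul (n : ℤ) n x x
    rw [if_pos rfl, inner_self_eq_norm_sq_to_K, inner_self_eq_norm_sq_to_K] at h
    have h' : ‖(memLp_fourier_smul (n : ℤ) x).toLp‖ ^ 2 = ‖x‖ ^ 2 := by exact_mod_cast h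
    exact (sq_eq_sq₀ (norm_nonneg _) (norm_nonneg _)).1 h'

/-- Orthogonality makes `(aₙ) ↦ ∑ ζⁿ aₙ` an isometry of `ℓ²` into `L²`, so boundary functions are
available before any radial limit is known to exist. -/
theorem orthogonalFamily_fourierEmb :
    OrthogonalFamily ℂ (fun _ : ℕ => E) (fun n => fourierEmb (E := E) n) := by
  intro m n hmn x y
  refine (inner_toLp_fourier_smul (m : ℤ) n x y).trans (if_neg ?_)
  exact_mod_cast hmn

theorem norm_sub_toCircle_pos {z : ℂ} (hz : ‖z‖ < 1) (t : AddCircle (2 * Real.pi)) :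
    0 < ‖(toCircle t : ℂ) - z‖ := by
  have := norm_sub_norm_le (toCircle t : ℂ) z
  rw [Circle.norm_coe] at this
  linarith

theorem continuous_poissonKernel_toCircle {z : ℂ} (hz : ‖z‖ < 1) :
    Continuous fun t : AddCircle (2 * Real.pi) => poissonKernel 0 z (toCircle t) := by
  have hc : Continuous fun t : AddCircle (2 * Real.pi) => (toCircle t : ℂ) :=
    continuous_subtype_val.comp continuous_toCircle
  unfold poissonKernel
  refine Continuous.div (by fun_prop) (by fun_prop) fun t => ?_
  have := norm_sub_toCircle_pos hz t
  simp only [sub_zero]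
  positivity

/-- For `n ≥ 0` the character is the trace on the circle of the entire function `w ↦ wⁿ x`, which
the Poisson formula reproduces. The case `n = 0` says that the kernel has mass one. -/
theorem integral_poissonKernel_smul_fourier [CompleteSpace E] {z : ℂ} (hz : ‖z‖ < 1) (n : ℕ) (x : E) :
    ∫ t, poissonKernel 0 z (toCircle t) • (fourier (n : ℤ) t • x) ∂circleMeasure = z ^ n • x := by
  have h := DiffContOnCl.circleAverage_poissonKernel_smul (f := fun w : ℂ => w ^ n • x) (c := 0)
    (R := 1) (w := z) (Differentiable.diffContOnCl (by fun_prop)) (by simpa using hz)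
  rw [← integral_circleMeasure_eq_circleAverage] at h
  rw [← h]
  refine integral_congr_ae (Eventually.of_forall fun t => ?_)
  simp only [Pi.smul_apply', Complex.ofReal_one, one_mul]
  rw [fourier_apply, natCast_zsmul, toCircle_nsmul, Circle.coe_pow]

theorem exists_norm_poissonKernel_le {z : ℂ} (hz : ‖z‖ < 1) :
    ∃ K : ℝ, ∀ t : AddCircle (2 * Real.pi), ‖poissonKernel 0 z (toCircle t)‖ ≤ K := by
  obtain ⟨K, hK⟩ := isCompact_univ.exists_bound_of_continuousOn
    (continuous_poissonKernel_toCircle hz).continuousOn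
  exact ⟨K, fun t => hK t trivial⟩

theorem integrable_poissonKernel_smul {F : Type*} [NormedAddCommGroup F] [NormedSpace ℝ F]
    {z : ℂ} (hz : ‖z‖ < 1) {g : AddCircle (2 * Real.pi) → F} (hg : Integrable g circleMeasure) :
    Integrable (fun t => poissonKernel 0 z (toCircle t) • g t) circleMeasure := by
  obtain ⟨K, hK⟩ := exists_norm_poissonKernel_le hz
  refine (hg.norm.const_mul K).mono'
    ((continuous_poissonKernel_toCircle hz).aestronglyMeasurable.smul hg.aestronglyMeasurable)
    (Eventually.of_forall fun t => ?_)
  rw [norm_smul]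
  exact mul_le_mul_of_nonneg_right (hK t) (norm_nonneg _)

/-- The Poisson integral at a point of the disc, as a continuous functional on `L²(𝕋, E)`. -/
theorem exists_poissonCLM {z : ℂ} (hz : ‖z‖ < 1) : ∃ T : Lp E 2 circleMeasure →L[ℂ] E,
    ∀ g, T g = ∫ t, poissonKernel 0 z (toCircle t) • g t ∂circleMeasure := by
  obtain ⟨K, hK⟩ := exists_norm_poissonKernel_le hz
  have hK0 : 0 ≤ K := (norm_nonneg _).trans (hK 0)
  refine ⟨LinearMap.mkContinuous
    { toFun := fun g => ∫ t, poissonKernel 0 z (toCircle t) • g t ∂circleMeasure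
      map_add' := fun g h => ?_
      map_smul' := fun w g => ?_ } K fun g => ?_, fun g => rfl⟩
  · rw [← integral_add (integrable_poissonKernel_smul hz (integrable_Lp_two g))
      (integrable_poissonKernel_smul hz (integrable_Lp_two h))]
    refine integral_congr_ae ?_
    filter_upwards [Lp.coeFn_add g h] with t ht
    rw [ht, Pi.add_apply, smul_add]
  · rw [RingHom.id_apply, ← integral_smul]
    refine integral_congr_ae ?_
    filter_upwards [Lp.coeFn_smul w g] with t ht
    rw [ht, Pi.smul_apply, smul_comm]
  -- The `L¹` norm is at most the `L²` norm because the measure is a probability measure.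
  · have h1 : ∫ t, ‖g t‖ ∂circleMeasure ≤ ‖g‖ := by
      rw [integral_norm_eq_lintegral_enorm (integrable_Lp_two g).aestronglyMeasurable,
        ← eLpNorm_one_eq_lintegral_enorm, Lp.norm_def]
      exact ENNReal.toReal_mono (Lp.eLpNorm_ne_top g)
        (eLpNorm_le_eLpNorm_of_exponent_le (by norm_num)
          (integrable_Lp_two g).aestronglyMeasurable)
    calc ‖∫ t, poissonKernel 0 z (toCircle t) • g t ∂circleMeasure‖
        ≤ ∫ t, K * ‖g t‖ ∂circleMeasure := by
          refine norm_integral_le_of_norm_le ((integrable_Lp_two g).norm.const_mul K)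
            (Eventually.of_forall fun t => ?_)
          rw [norm_smul]
          exact mul_le_mul_of_nonneg_right (hK t) (norm_nonneg _)
      _ ≤ K * ‖g‖ := by
          rw [integral_const_mul]
          exact mul_le_mul_of_nonneg_left h1 hK0

variable [CompleteSpace E]

/-- The boundary function in `L²(𝕋, E)` of a function in the Hardy space. -/
def boundary (f : HardySpace E) : Lp E 2 circleMeasure :=
  orthogonalFamily_fourierEmb.linearIsometry (coeffₗ f)

theorem norm_boundary (f : HardySpace E) : ‖boundary f‖ = ‖f‖ :=
  orthogonalFamily_fourierEmb.linearIsometry.norm_map _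

theorem hasSum_boundary (f : HardySpace E) :
    HasSum (fun n => fourierEmb n (coeff f n)) (boundary f) :=
  orthogonalFamily_fourierEmb.hasSum_linearIsometry (coeffₗ f)

/-- Functions in the Hardy space are the Poisson integrals of their boundary functions. -/
theorem integral_poissonKernel_boundary (f : HardySpace E) (z : 𝔻) :
    ∫ t, poissonKernel 0 z (toCircle t) • boundary f t ∂circleMeasure = f z := by
  obtain ⟨T, hT⟩ := exists_poissonCLM (E := E) z.norm_lt_one
  rw [← hT]
  -- Since `T` is continuous on `L²`, it may be applied to the Fourier series term by term; this
  -- produces the Taylor series.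
  refine ((hasSum_boundary f).mapL T).unique ?_
  convert hasSum_coeff f z using 2 with n
  rw [hT, ← integral_poissonKernel_smul_fourier z.norm_lt_one n]
  refine integral_congr_ae ?_
  filter_upwards [(memLp_fourier_smul (n : ℤ) (coeff f n)).coeFn_toLp] with t ht
  change _ • (memLp_fourier_smul (n : ℤ) (coeff f n)).toLp _ t = _
  rw [ht]

end Boundary

/-! ### A metric upper bound for the Poisson kernel. -/

section Kernel

/-- A chord is at least `2 / π` times the shorter arc. The angle is the absolute value of one
representative of `s - t`, and so bounds the quotient norm from above. -/
theorem mul_norm_sub_le_norm_toCircle_sub (s t : AddCircle (2 * Real.pi)) :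
    2 / Real.pi * ‖s - t‖ ≤ ‖(toCircle s : ℂ) - toCircle t‖ := by
  refine le_trans ?_ (Complex.mul_angle_le_norm_sub (Circle.norm_coe _) (Circle.norm_coe _))
  rw [Complex.angle_eq_abs_arg (Circle.coe_ne_zero _) (Circle.coe_ne_zero _), ← Circle.coe_div]
  have h : s - t = ((toCircle s / toCircle t : Circle) : ℂ).arg := by
    apply injective_toCircle Real.two_pi_pos.ne'
    rw [toCircle_apply_mk, div_self Real.two_pi_pos.ne', one_mul, Circle.exp_arg, sub_eq_add_neg,
      toCircle_add, toCircle_neg, div_eq_mul_inv]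
  gcongr
  rw [h]
  exact QuotientAddGroup.norm_mk_le_norm

/-- The kernel is `(1 - r²) / |w - rζ|²`, with numerator at most `2 (1 - r)`. The distance `|w -
rζ|` is at least `1 - r`, the length of the segment from `rζ` to `ζ`; hence `|w - ζ| ≤ 2 |w - rζ|`,
and the chord bound gives `dist s t ≤ π |w - rζ|`. The majorant depends only on distances, so masses
of balls suffice to estimate its integrals. -/
theorem norm_poissonKernel_radial_le {r : ℝ} (hr : 0 ≤ r) (hr1 : r < 1)
    (s t : AddCircle (2 * Real.pi)) :
    ‖poissonKernel 0 (r * toCircle t) (toCircle s)‖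
      ≤ 2 * (1 + Real.pi ^ 2) * ((1 - r) / ((1 - r) ^ 2 + dist s t ^ 2)) := by
  set w : ℂ := (toCircle s : ℂ)
  set ζ : ℂ := (toCircle t : ℂ)
  have hζ : ‖ζ‖ = 1 := Circle.norm_coe _
  have hw : ‖w‖ = 1 := Circle.norm_coe _
  have hz : ‖(r : ℂ) * ζ‖ = r := by
    rw [norm_mul, hζ, Complex.norm_real, Real.norm_of_nonneg hr, mul_one]
  have h1 : 1 - r ≤ ‖w - r * ζ‖ := by
    have := norm_sub_norm_le w (r * ζ)
    rwa [hw, hz] at this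
  have h2 : ‖w - ζ‖ ≤ 2 * ‖w - r * ζ‖ := by
    have h3 : ‖(r : ℂ) * ζ - ζ‖ = 1 - r := by
      have : (r : ℂ) * ζ - ζ = ((r - 1 : ℝ) : ℂ) * ζ := by push_cast; ring
      rw [this, norm_mul, hζ, Complex.norm_real, mul_one, Real.norm_eq_abs, abs_sub_comm,
        abs_of_pos (by linarith)]
    have := norm_sub_le_norm_sub_add_norm_sub w (r * ζ) ζ
    linarith
  have h4 : dist s t ≤ Real.pi * ‖w - r * ζ‖ := by
    have h5 := (mul_norm_sub_le_norm_toCircle_sub s t).trans h2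
    rw [dist_eq_norm]
    have hpi := Real.pi_pos
    rw [div_mul_eq_mul_div, div_le_iff₀ hpi] at h5
    linarith
  have hpos : 0 < ‖w - r * ζ‖ := lt_of_lt_of_le (by linarith) h1
  have hδ : 0 < 1 - r := by linarith
  rw [poissonKernel_def]
  simp only [sub_zero]
  rw [hw, hz, Real.norm_of_nonneg (div_nonneg (by nlinarith) (by positivity)), mul_div_assoc',
    div_le_div_iff₀ (by positivity) (by positivity)]
  have h6 : (1 - r) ^ 2 + dist s t ^ 2 ≤ (1 + Real.pi ^ 2) * ‖w - r * ζ‖ ^ 2 := by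
    have : dist s t ^ 2 ≤ (Real.pi * ‖w - r * ζ‖) ^ 2 := by gcongr
    have h7 : (1 - r) ^ 2 ≤ ‖w - r * ζ‖ ^ 2 := by gcongr
    nlinarith
  calc (1 ^ 2 - r ^ 2) * ((1 - r) ^ 2 + dist s t ^ 2)
      ≤ (2 * (1 - r)) * ((1 + Real.pi ^ 2) * ‖w - r * ζ‖ ^ 2) := by
        gcongr
        nlinarith
    _ = _ := by ring

end Kernel

/-! ### Concentration of the kernels `δ / (δ² + d²)`. -/

section ApproximateIdentity

variable {α : Type*} [PseudoMetricSpace α] [MeasurableSpace α] [OpensMeasurableSpace α]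

/-- If the mass of every ball around `x` is at most `ε` times its radius, then the integral of the
kernel `δ / (δ² + dist y x ²)` is at most `2 ε`. -/
theorem lintegral_kernel_le {ν : Measure α} {x : α} {ε δ : ℝ} (hε : 0 ≤ ε) (hδ : 0 < δ)
    (h : ∀ u > 0, ν (Metric.closedBall x u) ≤ ENNReal.ofReal (ε * u)) :
    ∫⁻ y, ENNReal.ofReal (δ / (δ ^ 2 + dist y x ^ 2)) ∂ν ≤ ENNReal.ofReal (2 * ε) := by
  -- Layer cake: the superlevel set at height `t` is empty for `t > 1 / δ`, and otherwise lies in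
  -- the ball of radius `√(δ / t)`. What remains is the integral of `ε √δ t ^ (-1/2)` over `(0, 1 /
  -- δ]`, which is `2 ε`.
  rw [lintegral_eq_lintegral_meas_le ν (Eventually.of_forall fun y => by positivity)
    (by fun_prop)]
  have hint : IntegrableOn (fun t : ℝ => ε * √δ * t ^ (-(1 / 2) : ℝ)) (Set.Ioc 0 δ⁻¹) := by
    refine Integrable.const_mul ?_ _
    exact (intervalIntegrable_iff_integrableOn_Ioc_of_le (by positivity)).1
      (intervalIntegral.intervalIntegrable_rpow' (by norm_num))
  calc ∫⁻ t in Set.Ioi 0, ν {y | t ≤ δ / (δ ^ 2 + dist y x ^ 2)}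
      ≤ ∫⁻ t in Set.Ioi 0, (Set.Ioc 0 δ⁻¹).indicator
          (fun t : ℝ => ENNReal.ofReal (ε * √δ * t ^ (-(1 / 2) : ℝ))) t := by
        refine setLIntegral_mono' measurableSet_Ioi fun t ht => ?_
        have ht0 : 0 < t := ht
        by_cases h1 : t ≤ δ⁻¹
        · rw [Set.indicator_of_mem (show t ∈ Set.Ioc 0 δ⁻¹ from ⟨ht0, h1⟩)]
          have h2 : {y | t ≤ δ / (δ ^ 2 + dist y x ^ 2)} ⊆ Metric.closedBall x (√(δ / t)) := by
            intro y hy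
            rw [Set.mem_ofPred_eq, le_div_iff₀ (by positivity)] at hy
            rw [Metric.mem_closedBall]
            refine Real.le_sqrt_of_sq_le ?_
            rw [le_div_iff₀ ht0]
            nlinarith [mul_pos ht0 (pow_pos hδ 2)]
          refine (measure_mono h2).trans ((h _ (by positivity)).trans_eq ?_)
          rw [Real.sqrt_div hδ.le, Real.rpow_neg ht0.le, ← Real.sqrt_eq_rpow, mul_assoc,
            div_eq_mul_inv]
        · have h2 : {y | t ≤ δ / (δ ^ 2 + dist y x ^ 2)} = ∅ := by
            refine Set.eq_empty_of_forall_notMem fun y hy => h1 (le_trans hy ?_)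
            rw [div_le_iff₀ (by positivity), mul_add]
            have : δ⁻¹ * δ ^ 2 = δ := by field_simp
            rw [this]
            have : 0 ≤ δ⁻¹ * dist y x ^ 2 := by positivity
            linarith
          rw [h2]
          simp
    _ = ∫⁻ t in Set.Ioc 0 δ⁻¹, ENNReal.ofReal (ε * √δ * t ^ (-(1 / 2) : ℝ)) := by
        rw [lintegral_indicator measurableSet_Ioc, Measure.restrict_restrict measurableSet_Ioc,
          Set.inter_eq_left.2 Set.Ioc_subset_Ioi_self]
    _ = ENNReal.ofReal (∫ t in Set.Ioc 0 δ⁻¹, ε * √δ * t ^ (-(1 / 2) : ℝ)) := by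
        rw [ofReal_integral_eq_lintegral_ofReal hint]
        filter_upwards [ae_restrict_mem measurableSet_Ioc] with t ht
        have := ht.1
        change 0 ≤ ε * √δ * t ^ (-(1 / 2) : ℝ)
        positivity
    _ = ENNReal.ofReal (2 * ε) := by
        rw [← intervalIntegral.integral_of_le (by positivity),
          intervalIntegral.integral_const_mul, integral_rpow (Or.inl (by norm_num))]
        congr 1
        have : (-(1 / 2) + 1 : ℝ) = 1 / 2 := by norm_num
        rw [this, Real.zero_rpow (by norm_num), ← Real.sqrt_eq_rpow, Real.sqrt_inv]
        have h3 : √δ ≠ 0 := (Real.sqrt_pos.2 hδ).ne'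
        field_simp
        simp

/-- If the mass of the balls around `x` is `o(u)`, `u` being the radius, then the integrals of the
kernels `δ / (δ² + dist y x ²)` tend to `0`. -/
theorem tendsto_lintegral_kernel {ν : Measure α} [IsFiniteMeasure ν] {x : α}
    (h : ∀ ε > 0, ∀ᶠ u in 𝓝[>] (0 : ℝ), ν (Metric.closedBall x u) ≤ ENNReal.ofReal (ε * u)) :
    Tendsto (fun δ : ℝ => ∫⁻ y, ENNReal.ofReal (δ / (δ ^ 2 + dist y x ^ 2)) ∂ν) (𝓝[>] 0)
      (𝓝 0) := by
  rw [ENNReal.tendsto_nhds_zero]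
  intro ε hε
  obtain ⟨ε', hε'0, hε'⟩ : ∃ ε' : ℝ, 0 < ε' ∧ ENNReal.ofReal (2 * ε') ≤ ε / 2 := by
    obtain ⟨q, hq0, hq⟩ := ENNReal.lt_iff_exists_nnreal_btwn.1 (ENNReal.half_pos hε.ne')
    refine ⟨q / 2, half_pos (by exact_mod_cast hq0), ?_⟩
    rw [mul_div_cancel₀ _ two_ne_zero, ENNReal.ofReal_coe_nnreal]
    exact hq.le
  obtain ⟨η, hη0, hη⟩ := mem_nhdsGT_iff_exists_Ioc_subset.1 (h ε' hε'0)
  have hη0' : 0 < η := hη0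
  have hnear : ∀ δ > 0, ∫⁻ y in Metric.closedBall x η,
      ENNReal.ofReal (δ / (δ ^ 2 + dist y x ^ 2)) ∂ν ≤ ε / 2 := by
    intro δ hδ
    -- Restricting `ν` to the ball of radius `η` makes the mass bound valid for every radius: beyond
    -- `η` the mass no longer grows, while the bound does.
    refine (lintegral_kernel_le hε'0.le hδ fun u hu => ?_).trans hε'
    rcases le_total u η with hu' | hu'
    · exact (Measure.restrict_apply_le _ _).trans (hη ⟨hu, hu'⟩)
    · refine (measure_mono (Set.subset_univ _)).trans ?_
      rw [Measure.restrict_apply_univ]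
      refine (hη ⟨hη0', le_rfl⟩ : ν (Metric.closedBall x η) ≤ _).trans ?_
      gcongr
  -- Away from the ball the kernel is at most `δ / η²`, and `ν` is finite.
  have hfar : Tendsto (fun δ : ℝ => ENNReal.ofReal (δ / η ^ 2) * ν Set.univ) (𝓝[>] 0) (𝓝 0) := by
    have h1 : Tendsto (fun δ : ℝ => ENNReal.ofReal (δ / η ^ 2)) (𝓝[>] 0) (𝓝 0) := by
      have h2 : Continuous fun δ : ℝ => ENNReal.ofReal (δ / η ^ 2) :=
        ENNReal.continuous_ofReal.comp (continuous_id.div_const _)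
      have := h2.tendsto 0
      simp only [zero_div, ENNReal.ofReal_zero] at this
      exact this.mono_left nhdsWithin_le_nhds
    have h3 := ENNReal.Tendsto.mul_const h1 (Or.inr (measure_ne_top ν Set.univ))
    rwa [zero_mul] at h3
  filter_upwards [self_mem_nhdsWithin,
    ENNReal.tendsto_nhds_zero.1 hfar (ε / 2) (ENNReal.half_pos hε.ne')] with δ hδ hδ2
  have hδ0 : 0 < δ := hδ
  rw [← lintegral_add_compl _ (Metric.isClosed_closedBall (x := x) (ε := η)).measurableSet,
    ← ENNReal.add_halves ε]
  refine add_le_add (hnear δ hδ) (le_trans ?_ hδ2)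
  calc ∫⁻ y in (Metric.closedBall x η)ᶜ, ENNReal.ofReal (δ / (δ ^ 2 + dist y x ^ 2)) ∂ν
      ≤ ∫⁻ _y in (Metric.closedBall x η)ᶜ, ENNReal.ofReal (δ / η ^ 2) ∂ν := by
        refine setLIntegral_mono' Metric.isClosed_closedBall.measurableSet.compl fun y hy => ?_
        have hy' : η < dist y x := by simpa using hy
        gcongr
        nlinarith
    _ ≤ _ := by
        rw [setLIntegral_const]
        gcongr
        exact Set.subset_univ _

end ApproximateIdentity

/-! ### Lebesgue points and Fatou's theorem. -/

section Fatou

variable {E : Type*} [NormedAddCommGroup E]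

/-- Almost every point of the circle is a Lebesgue point of an integrable function. -/
theorem ae_lebesgue_point {g : AddCircle (2 * Real.pi) → E} (hg : Integrable g volume) :
    ∀ᵐ t ∂(volume : Measure (AddCircle (2 * Real.pi))), ∀ ε > 0, ∀ᶠ u in 𝓝[>] (0 : ℝ),
      (volume.withDensity fun s => ‖g s - g t‖ₑ) (Metric.closedBall t u)
        ≤ ENNReal.ofReal (ε * u) := by
  filter_upwards [IsUnifLocDoublingMeasure.ae_tendsto_average_norm_sub volume
    hg.locallyIntegrable 1] with t ht ε hε
  have h1 := ht (l := 𝓝[>] (0 : ℝ)) (fun _ => t) id tendsto_id (by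
    filter_upwards [self_mem_nhdsWithin] with u hu
    exact Metric.mem_closedBall_self (by simpa using le_of_lt hu))
  -- For `u < π` the ball has volume `2 u`, so an average below `ε / 2` means a mass below `ε u`.
  filter_upwards [h1.eventually (gt_mem_nhds (half_pos hε)), Ioo_mem_nhdsGT Real.pi_pos]
    with u hu hu'
  simp only [id] at hu
  rw [withDensity_apply _ Metric.isClosed_closedBall.measurableSet]
  have hi : IntegrableOn (fun s => g s - g t) (Metric.closedBall t u) volume :=
    (hg.sub (integrable_const _)).integrableOn
  have h2 := ofReal_integral_norm_eq_lintegral_enorm hi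
  rw [← h2]
  refine ENNReal.ofReal_le_ofReal ?_
  rw [setAverage_eq, measureReal_def, volume_closedBall, min_eq_right (by linarith [hu'.2]),
    ENNReal.toReal_ofReal (by linarith [hu'.1]), smul_eq_mul, inv_mul_lt_iff₀ (by linarith [hu'.1])] at hu
  linarith

/-- The two measures differ by the factor `2π ≥ 1`. This carries estimates from `volume`, where
balls have explicit size, to the normalized measure. -/
theorem circleMeasure_le_volume :
    circleMeasure ≤ (volume : Measure (AddCircle (2 * Real.pi))) := by
  rw [volume_eq_smul_haarAddCircle]
  intro s
  rw [Measure.smul_apply, smul_eq_mul]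
  refine le_mul_of_one_le_left' ?_
  rw [ENNReal.one_le_ofReal]
  linarith [Real.pi_gt_three]

variable [InnerProductSpace ℂ E] [CompleteSpace E]

/-- **Fatou's theorem** for the vector-valued Hardy space: almost all radial limits exist and agree
with the boundary function. -/
theorem ae_tendsto_radial (f : HardySpace E) {F : ℂ → E} (hF : ∀ z : 𝔻, F z = f z) :
    ∀ᵐ t ∂circleMeasure,
      Tendsto (fun r : ℝ => F (r * toCircle t)) (𝓝[<] 1) (𝓝 (boundary f t)) := by
  have hg := integrable_Lp_two (boundary f)
  have hgv : Integrable (boundary f) (volume : Measure (AddCircle (2 * Real.pi))) := by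
    rw [volume_eq_smul_haarAddCircle]
    exact hg.smul_measure ENNReal.ofReal_ne_top
  filter_upwards [circleMeasure_le_volume.absolutelyContinuous.ae_le (ae_lebesgue_point hgv)] with t ht
  set g := boundary f
  set ν : Measure (AddCircle (2 * Real.pi)) := volume.withDensity fun s => ‖g s - g t‖ₑ
  have hgt : Integrable (fun s => g s - g t) (volume : Measure (AddCircle (2 * Real.pi))) :=
    hgv.sub (integrable_const _)
  have hν : IsFiniteMeasure ν := isFiniteMeasure_withDensity hgt.2.ne
  have hlim := tendsto_lintegral_kernel ht
  have hsub : Tendsto (fun r : ℝ => 1 - r) (𝓝[<] 1) (𝓝[>] 0) := by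
    refine tendsto_nhdsWithin_iff.2 ⟨?_, ?_⟩
    · have h : Continuous fun r : ℝ => 1 - r := by fun_prop
      have h' := h.tendsto 1
      rw [sub_self] at h'
      exact h'.mono_left nhdsWithin_le_nhds
    · filter_upwards [self_mem_nhdsWithin] with r hr
      exact sub_pos.2 (Set.mem_Iio.1 hr)
  -- The kernel parameter is `δ = 1 - r`, and the constant is the one in
  -- `norm_poissonKernel_radial_le`.
  have hlim' := ENNReal.Tendsto.const_mul (a := ENNReal.ofReal (2 * (1 + Real.pi ^ 2)))
    (hlim.comp hsub) (Or.inr ENNReal.ofReal_ne_top)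
  rw [mul_zero] at hlim'
  rw [tendsto_iff_edist_tendsto_0]
  refine tendsto_of_tendsto_of_tendsto_of_le_of_le' tendsto_const_nhds hlim'
    (Eventually.of_forall fun _ => zero_le) ?_
  filter_upwards [Ioo_mem_nhdsLT (show (0 : ℝ) < 1 by norm_num)] with r hr
  have hz : ‖(r * toCircle t : ℂ)‖ < 1 := (radialPt r hr.1.le hr.2 t).norm_lt_one
  -- As the kernel has mass one, `F (rζ) - g t` is the Poisson integral of `g - g t`, which the
  -- kernel integral against `ν` controls.
  have hone : ∫ s, poissonKernel 0 (r * toCircle t) (toCircle s) • g t ∂circleMeasure = g t := by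
    simpa using integral_poissonKernel_smul_fourier hz 0 (g t)
  have hF' : F (r * toCircle t)
      = ∫ s, poissonKernel 0 (r * toCircle t) (toCircle s) • g s ∂circleMeasure :=
    (hF (radialPt r hr.1.le hr.2 t)).trans (integral_poissonKernel_boundary f _).symm
  have hrep : F (r * toCircle t) - g t = ∫ s,
      poissonKernel 0 (r * toCircle t) (toCircle s) • (g s - g t) ∂circleMeasure := by
    simp only [smul_sub]
    rw [integral_sub (integrable_poissonKernel_smul hz hg)
      (integrable_poissonKernel_smul hz (integrable_const _)), hone, ← hF']
  rw [edist_eq_enorm_sub, hrep]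
  calc ‖∫ s, poissonKernel 0 (r * toCircle t) (toCircle s) • (g s - g t) ∂circleMeasure‖ₑ
      ≤ ∫⁻ s, ‖poissonKernel 0 (r * toCircle t) (toCircle s) • (g s - g t)‖ₑ ∂circleMeasure :=
        enorm_integral_le_lintegral_enorm _
    _ ≤ ∫⁻ s, ‖poissonKernel 0 (r * toCircle t) (toCircle s) • (g s - g t)‖ₑ :=
        lintegral_mono' circleMeasure_le_volume le_rfl
    _ ≤ ∫⁻ s, ENNReal.ofReal (2 * (1 + Real.pi ^ 2)) * (‖g s - g t‖ₑ *
          ENNReal.ofReal ((1 - r) / ((1 - r) ^ 2 + dist s t ^ 2))) := by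
        refine lintegral_mono fun s => ?_
        rw [enorm_smul, mul_comm ‖g s - g t‖ₑ, ← mul_assoc,
          ← ENNReal.ofReal_mul (by positivity)]
        gcongr
        rw [← ofReal_norm]
        exact ENNReal.ofReal_le_ofReal (norm_poissonKernel_radial_le hr.1.le hr.2 s t)
    _ = ENNReal.ofReal (2 * (1 + Real.pi ^ 2)) *
          ∫⁻ s, ENNReal.ofReal ((1 - r) / ((1 - r) ^ 2 + dist s t ^ 2)) ∂ν := by
        rw [lintegral_const_mul' _ _ ENNReal.ofReal_ne_top]
        congr 1
        exact (lintegral_withDensity_eq_lintegral_mul₀ hgt.aestronglyMeasurable.enorm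
          (by fun_prop)).symm

end Fatou

/-! ### Jensen's formula and boundary uniqueness. -/

section Uniqueness

theorem analyticOnNhd_closedBall {u : ℂ → ℂ} (hu : DifferentiableOn ℂ u (Metric.ball 0 1)) {r : ℝ}
    (hr : 0 < r) (hr1 : r < 1) : AnalyticOnNhd ℂ u (Metric.closedBall 0 |r|) := by
  rw [abs_of_pos hr]
  exact (hu.analyticOnNhd Metric.isOpen_ball).mono (Metric.closedBall_subset_ball hr1)

/-- The circle averages of `log |u|` of an analytic function on the disc are bounded below. -/
theorem exists_le_circleAverage_log {u : ℂ → ℂ} (hu : DifferentiableOn ℂ u (Metric.ball 0 1)) :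
    ∃ c : ℝ, ∀ r : ℝ, 1 / 2 ≤ r → r < 1 →
      c ≤ Real.circleAverage (fun z => Real.log ‖u z‖) 0 r := by
  -- The bound is Jensen's formula with the nonnegative contributions of the zeros dropped and `log
  -- r` replaced by `log (1 / 2)`.
  refine ⟨((meromorphicOrderAt u 0).untop₀ : ℝ) * Real.log (1 / 2)
    + Real.log ‖meromorphicTrailingCoeffAt u 0‖, fun r hr hr1 => ?_⟩
  have hr0 : 0 < r := by linarith
  have ha := analyticOnNhd_closedBall hu hr0 hr1
  have hnn := MeromorphicOn.AnalyticOnNhd.divisor_nonneg ha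
  have h0 : (0 : ℂ) ∈ Metric.closedBall (0 : ℂ) |r| := by simp
  rw [ha.meromorphicOn.circleAverage_log_norm hr0.ne', ha.meromorphicOn.divisor_apply h0]
  have h1 : 0 ≤ ∑ᶠ v, (MeromorphicOn.divisor u (Metric.closedBall 0 |r|) v : ℝ)
      * Real.log (r * ‖0 - v‖⁻¹) := by
    refine finsum_nonneg fun v => ?_
    by_cases hv : v ∈ Metric.closedBall (0 : ℂ) |r|
    · refine mul_nonneg (by exact_mod_cast hnn v) ?_
      -- At `v = 0` the logarithm is `Real.log 0 = 0`; a zero at the origin is counted in the order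
      -- term instead.
      rcases eq_or_ne v 0 with rfl | hv0
      · simp
      · refine Real.log_nonneg ?_
        have hv' : ‖v‖ ≤ r := by simpa [abs_of_pos hr0] using hv
        rw [zero_sub, norm_neg, ← div_eq_mul_inv, one_le_div (norm_pos_iff.2 hv0)]
        exact hv'
    · rw [Function.locallyFinsuppWithin.apply_eq_zero_of_notMem _ hv]
      simp
  have h2 : 0 ≤ ((meromorphicOrderAt u 0).untop₀ : ℝ) := by
    have := hnn 0
    rw [ha.meromorphicOn.divisor_apply h0] at this
    exact_mod_cast this
  have h3 : Real.log (1 / 2) ≤ Real.log r := Real.log_le_log (by norm_num) hr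
  have h4 := mul_le_mul_of_nonneg_left h3 h2
  linarith

theorem continuous_comp_circle {F : Type*} [TopologicalSpace F] {u : ℂ → F}
    (hu : ContinuousOn u (Metric.ball 0 1)) {r : ℝ} (hr : 0 ≤ r) (hr1 : r < 1) :
    Continuous fun t : AddCircle (2 * Real.pi) => u (r * toCircle t) := by
  refine hu.comp_continuous
    (continuous_const.mul (continuous_subtype_val.comp continuous_toCircle)) fun t => ?_
  rw [mem_ball_zero_iff]
  exact (radialPt r hr hr1 t).norm_lt_one

/-- Truncation only raises the true logarithm, so the Jensen bound persists with `c` independent of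
`r` and `ε`, while the integrand becomes continuous. -/
theorem exists_le_integral_log_max {u : ℂ → ℂ} (hu : DifferentiableOn ℂ u (Metric.ball 0 1))
    {z₀ : ℂ} (hz₀ : z₀ ∈ Metric.ball (0 : ℂ) 1) (h0 : u z₀ ≠ 0) :
    ∃ c : ℝ, ∀ r : ℝ, 1 / 2 ≤ r → r < 1 → ∀ ε : ℝ, 0 < ε →
      c ≤ ∫ t, Real.log (max ‖u (r * toCircle t)‖ ε) ∂circleMeasure := by
  obtain ⟨c, hc⟩ := exists_le_circleAverage_log hu
  refine ⟨c, fun r hr hr1 ε hε => (hc r hr hr1).trans ?_⟩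
  have hr0 : 0 < r := by linarith
  rw [integral_circleMeasure_eq_circleAverage (fun z => Real.log (max ‖u z‖ ε))]
  have hsub : Metric.sphere (0 : ℂ) |r| ⊆ Metric.ball 0 1 := by
    rw [abs_of_pos hr0]
    exact Metric.sphere_subset_closedBall.trans (Metric.closedBall_subset_ball hr1)
  have hne : ∀ᶠ z in codiscreteWithin (Metric.sphere (0 : ℂ) |r|), u z ≠ 0 := by
    refine (Filter.codiscreteWithin_mono hsub) ?_
    exact ((hu.analyticOnNhd Metric.isOpen_ball).eqOn_zero_or_eventually_ne_zero_of_preconnected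
      (convex_ball (0 : ℂ) 1).isPreconnected).resolve_left fun h => h0 (h hz₀)
  -- Since `Real.log 0 = 0`, the pointwise inequality can fail at zeros of `u`. Taking the minimum
  -- repairs it and changes the function only on a discrete set, which the circle average ignores.
  have hcongr : (fun z => Real.log ‖u z‖) =ᶠ[codiscreteWithin (Metric.sphere (0 : ℂ) |r|)]
      fun z => min (Real.log ‖u z‖) (Real.log (max ‖u z‖ ε)) := by
    filter_upwards [hne] with z hz
    rw [min_eq_left]
    exact Real.log_le_log (norm_pos_iff.2 hz) (le_max_left _ _)
  have hint : CircleIntegrable (fun z => Real.log ‖u z‖) 0 r :=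
    MeromorphicOn.circleIntegrable_log_norm
      ((hu.analyticOnNhd Metric.isOpen_ball).mono hsub).meromorphicOn
  rw [Real.circleAverage_congr_codiscreteWithin hcongr hr0.ne']
  refine Real.circleAverage_mono (hint.congr_codiscreteWithin hcongr) ?_ fun z _ => min_le_right _ _
  refine ContinuousOn.circleIntegrable' ?_
  refine ContinuousOn.log ?_ fun z _ => (lt_max_of_lt_right hε).ne'
  exact continuous_max.comp_continuousOn
    ((hu.continuousOn.mono hsub).norm.prodMk continuousOn_const)

/-- A nonzero analytic function on the disc with bounded `L²` means has radial limit zero almost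
nowhere. -/
theorem ae_not_tendsto_zero {u : ℂ → ℂ} (hu : DifferentiableOn ℂ u (Metric.ball 0 1))
    {z₀ : ℂ} (hz₀ : z₀ ∈ Metric.ball (0 : ℂ) 1) (h0 : u z₀ ≠ 0) {K : ℝ}
    (hK : ∀ r : ℝ, 0 ≤ r → r < 1 → ∫ t, ‖u (r * toCircle t)‖ ^ 2 ∂circleMeasure ≤ K) :
    ∀ᵐ t ∂circleMeasure, ¬ Tendsto (fun r : ℝ => u (r * toCircle t)) (𝓝[<] 1) (𝓝 0) := by
  obtain ⟨c, hc⟩ := exists_le_integral_log_max hu hz₀ h0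
  obtain ⟨ρ, -, hρ, hρlim⟩ := exists_seq_strictMono_tendsto' (show (1 / 2 : ℝ) < 1 by norm_num)
  set N : Set (AddCircle (2 * Real.pi)) :=
    {t | Tendsto (fun r : ℝ => u (r * toCircle t)) (𝓝[<] 1) (𝓝 0)}
  have key : ∀ M : ℝ, 0 ≤ M → ENNReal.ofReal M * circleMeasure N ≤ ENNReal.ofReal (K - c) := by
    intro M hM
    -- These functions are nonnegative, because `M ≥ 0` and `log x ≤ x - 1 ≤ x²`; their integrals
    -- are at most `K - c`, and on `N` they tend to `M`. Markov's inequality and Fatou's lemma give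
    -- `M * m(N) ≤ K - c`. Only the liminf has to be measurable, not `N`.
    set h : ℕ → AddCircle (2 * Real.pi) → ℝ := fun n t =>
      ‖u (ρ n * toCircle t)‖ ^ 2 - Real.log (max ‖u (ρ n * toCircle t)‖ (Real.exp (-M)))
    have hcu : ∀ n, Continuous fun t : AddCircle (2 * Real.pi) => u (ρ n * toCircle t) := fun n =>
      continuous_comp_circle hu.continuousOn (by linarith [(hρ n).1]) (hρ n).2
    have hcl : ∀ n, Continuous fun t : AddCircle (2 * Real.pi) =>
        Real.log (max ‖u (ρ n * toCircle t)‖ (Real.exp (-M))) := fun n =>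
      ((hcu n).norm.max continuous_const).log
        fun t => (lt_max_of_lt_right (Real.exp_pos _)).ne'
    have hch : ∀ n, Continuous (h n) := fun n => ((hcu n).norm.pow 2).sub (hcl n)
    have hnn : ∀ n t, 0 ≤ h n t := by
      intro n t
      simp only [h, sub_nonneg]
      rcases le_total ‖u (ρ n * toCircle t)‖ (Real.exp (-M)) with h1 | h1
      · rw [max_eq_right h1, Real.log_exp]
        nlinarith [sq_nonneg ‖u (ρ n * toCircle t)‖]
      · rw [max_eq_left h1]
        have := Real.log_le_sub_one_of_pos ((Real.exp_pos _).trans_le h1)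
        nlinarith [sq_nonneg (‖u (ρ n * toCircle t)‖ - 1), sq_nonneg ‖u (ρ n * toCircle t)‖]
    have hint : ∀ n, ∫⁻ t, ENNReal.ofReal (h n t) ∂circleMeasure ≤ ENNReal.ofReal (K - c) := by
      intro n
      rw [← ofReal_integral_eq_lintegral_ofReal (integrable_of_continuous (hch n))
        (Eventually.of_forall (hnn n))]
      refine ENNReal.ofReal_le_ofReal ?_
      have h0 : ∫ t, h n t ∂circleMeasure = _ :=
        integral_sub (integrable_of_continuous ((hcu n).norm.pow 2))
          (integrable_of_continuous (hcl n))
      rw [h0]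
      have h1 := hK (ρ n) (by linarith [(hρ n).1]) (hρ n).2
      have h2 := hc (ρ n) (hρ n).1.le (hρ n).2 _ (Real.exp_pos (-M))
      exact sub_le_sub h1 h2
    have hsubset : N ⊆ {t | ENNReal.ofReal M
        ≤ liminf (fun n => ENNReal.ofReal (h n t)) atTop} := by
      intro t ht
      have h1 : Tendsto ρ atTop (𝓝[<] 1) :=
        tendsto_nhdsWithin_iff.2 ⟨hρlim, Eventually.of_forall fun n => (hρ n).2⟩
      have h2 : Tendsto (fun n => ‖u (ρ n * toCircle t)‖) atTop (𝓝 0) := by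
        have h3 : Tendsto (fun r : ℝ => u (r * toCircle t)) (𝓝[<] 1) (𝓝 0) := ht
        simpa using (h3.comp h1).norm
      have h4 : Tendsto (fun n => h n t) atTop (𝓝 M) := by
        have h5 : Continuous fun x : ℝ => x ^ 2 - Real.log (max x (Real.exp (-M))) :=
          (continuous_pow 2).sub ((continuous_id.max continuous_const).log
            fun x => (lt_max_of_lt_right (Real.exp_pos _)).ne')
        have h6 := (h5.tendsto 0).comp h2
        rw [max_eq_right (Real.exp_pos _).le, Real.log_exp, zero_pow two_ne_zero, zero_sub,
          neg_neg] at h6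
        exact h6
      exact (((ENNReal.continuous_ofReal.tendsto M).comp h4).liminf_eq).ge
    have hmeas : ∀ n, Measurable fun t => ENNReal.ofReal (h n t) := fun n =>
      (hch n).measurable.ennreal_ofReal
    calc ENNReal.ofReal M * circleMeasure N
        ≤ ENNReal.ofReal M * circleMeasure {t | ENNReal.ofReal M
            ≤ liminf (fun n => ENNReal.ofReal (h n t)) atTop} := by gcongr
      _ ≤ ∫⁻ t, liminf (fun n => ENNReal.ofReal (h n t)) atTop ∂circleMeasure :=
          mul_meas_ge_le_lintegral (Measurable.liminf hmeas) _
      _ ≤ liminf (fun n => ∫⁻ t, ENNReal.ofReal (h n t) ∂circleMeasure) atTop :=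
          lintegral_liminf_le hmeas
      _ ≤ ENNReal.ofReal (K - c) := by
          refine (liminf_le_liminf (Eventually.of_forall hint)).trans ?_
          rw [liminf_const]
  have hN : circleMeasure N = 0 := by
    by_contra hne
    have h1 : Tendsto (fun n : ℕ => (n : ℝ≥0∞) * circleMeasure N) atTop (𝓝 ∞) := by
      have := ENNReal.Tendsto.mul_const (b := circleMeasure N) ENNReal.tendsto_nat_nhds_top
        (Or.inl ENNReal.top_ne_zero)
      rwa [ENNReal.top_mul hne] at this
    have h2 := le_of_tendsto' h1 (b := ENNReal.ofReal (K - c)) fun n => by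
      have := key n (Nat.cast_nonneg n)
      rwa [ENNReal.ofReal_natCast] at this
    exact ENNReal.ofReal_ne_top (top_le_iff.1 h2)
  rw [ae_iff]
  simpa using hN

end Uniqueness

/-! ### Szegő kernels and the norm of `M_Φ`. -/

section NormOfToeplitz

variable {E : Type*} [NormedAddCommGroup E] [InnerProductSpace ℂ E] [CompleteSpace E]

theorem one_sub_norm_sq_pos (w : 𝔻) : 0 < 1 - ‖(w : ℂ)‖ ^ 2 := by
  have h1 := w.norm_lt_one
  have h2 := norm_nonneg (w : ℂ)
  nlinarith

/-- Point evaluations on the Hardy space are bounded. -/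
theorem norm_sq_apply_le (f : HardySpace E) (w : 𝔻) :
    ‖f w‖ ^ 2 ≤ (1 - ‖(w : ℂ)‖ ^ 2)⁻¹ * ‖f‖ ^ 2 := by
  have hw := one_sub_norm_sq_pos w
  have hgeom := hasSum_geometric_of_lt_one (sq_nonneg ‖(w : ℂ)‖) (by linarith)
  have hlim := ((hasSum_coeff f w).tendsto_sum_nat.norm).pow 2
  refine le_of_tendsto' hlim fun N => ?_
  calc ‖∑ n ∈ Finset.range N, (w : ℂ) ^ n • coeff f n‖ ^ 2
      ≤ (∑ n ∈ Finset.range N, ‖(w : ℂ)‖ ^ n * ‖coeff f n‖) ^ 2 := by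
        gcongr
        refine norm_sum_le_of_le _ fun n _ => ?_
        rw [norm_smul, norm_pow]
    _ ≤ (∑ n ∈ Finset.range N, (‖(w : ℂ)‖ ^ n) ^ 2)
          * ∑ n ∈ Finset.range N, ‖coeff f n‖ ^ 2 := Finset.sum_mul_sq_le_sq_mul_sq _ _ _
    _ ≤ (1 - ‖(w : ℂ)‖ ^ 2)⁻¹ * ‖f‖ ^ 2 := by
        rw [norm_sq_eq]
        gcongr
        · simp only [← pow_mul, mul_comm _ 2]
          simp only [pow_mul]
          exact sum_le_hasSum _ (fun n _ => by positivity) hgeom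
        · exact (summable_coeff f).sum_le_tsum _ fun n _ => by positivity

/-- The Szegő kernel functions `z ↦ (1 - z w̄)⁻¹ x`. -/
theorem exists_kernel (w : 𝔻) (x : E) : ∃ k : HardySpace E,
    (∀ z : 𝔻, k z = (1 - (z : ℂ) * starRingEnd ℂ w)⁻¹ • x) ∧
      ‖k‖ ^ 2 = (1 - ‖(w : ℂ)‖ ^ 2)⁻¹ * ‖x‖ ^ 2 := by
  have hw := one_sub_norm_sq_pos w
  have hsq : HasSum (fun n => ‖(starRingEnd ℂ w) ^ n • x‖ ^ 2)
      ((1 - ‖(w : ℂ)‖ ^ 2)⁻¹ * ‖x‖ ^ 2) := by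
    have := (hasSum_geometric_of_lt_one (sq_nonneg ‖(w : ℂ)‖) (by linarith)).mul_right (‖x‖ ^ 2)
    have hterm : ∀ n, ‖(starRingEnd ℂ) w ^ n • x‖ ^ 2 = (‖(w : ℂ)‖ ^ 2) ^ n * ‖x‖ ^ 2 := fun n => by
     
      rw [norm_smul, norm_pow, RCLike.norm_conj, mul_pow, ← pow_mul, ← pow_mul, mul_comm n]
    simpa only [hterm] using this
  have hval : ∀ z : 𝔻, HasSum (fun n => (z : ℂ) ^ n • ((starRingEnd ℂ w) ^ n • x))
      ((1 - (z : ℂ) * starRingEnd ℂ w)⁻¹ • x) := by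
    intro z
    have hlt : ‖(z : ℂ) * starRingEnd ℂ w‖ < 1 := by
      rw [norm_mul, RCLike.norm_conj]
      exact mul_lt_one_of_nonneg_of_lt_one_left (norm_nonneg _) z.norm_lt_one w.norm_lt_one.le
    have := (hasSum_geometric_of_norm_lt_one hlt).smul_const x
    simpa only [mul_pow, smul_smul] using this
  let k : HardySpace E := ⟨_, _, hsq.summable, hval⟩
  refine ⟨k, fun z => rfl, ?_⟩
  rw [norm_sq_eq k, ← hsq.tsum_eq]
  exact congrArg (fun a : ℕ → E => ∑' n, ‖a n‖ ^ 2) (coeff_unique (hasSum_coeff k) hval)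

theorem exists_const (x : E) : ∃ k : HardySpace E, (∀ z : 𝔻, k z = x) ∧ ‖k‖ = ‖x‖ := by
  obtain ⟨k, hk, hn⟩ := exists_kernel 0 x
  refine ⟨k, fun z => by simpa using hk z, ?_⟩
  refine (sq_eq_sq₀ (norm_nonneg _) (norm_nonneg _)).1 ?_
  simpa using hn

/-- For the lower bound take the Szegő kernel `k` at `w` in direction `x`, and `q = (1 - |w|²)⁻¹`.
Then `k w = q x` and `‖k‖² = q ‖x‖²`, so bounding the evaluation of `M_Φ k` at `w` gives `q² ‖Φ(w)
x‖² ≤ q² ‖M_Φ‖² ‖x‖²`. -/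
theorem norm_mulOp {Φ : ℂ → E →L[ℂ] E} (hΦ : IsHInfty Φ) :
    ‖mulOp Φ hΦ‖ = hInftyNorm Φ := by
  refine le_antisymm (LinearMap.mkContinuous_norm_le _ (hInftyNorm_nonneg Φ) _) ?_
  refine Real.iSup_le (fun w => ?_) (norm_nonneg _)
  refine ContinuousLinearMap.opNorm_le_bound _ (norm_nonneg _) fun x => ?_
  have hw := one_sub_norm_sq_pos w
  obtain ⟨k, hk, hn⟩ := exists_kernel w x
  have h1 := norm_sq_apply_le (mulOp Φ hΦ k) w
  have h2 : ‖mulOp Φ hΦ k‖ ^ 2 ≤ (‖mulOp Φ hΦ‖ * ‖k‖) ^ 2 := by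
    gcongr
    exact ContinuousLinearMap.le_opNorm _ _
  have h3 : ‖(1 - (w : ℂ) * starRingEnd ℂ w)⁻¹‖ = (1 - ‖(w : ℂ)‖ ^ 2)⁻¹ := by
    rw [Complex.mul_conj, Complex.normSq_eq_norm_sq, norm_inv, ← Complex.ofReal_one,
      ← Complex.ofReal_sub, Complex.norm_real, Real.norm_of_nonneg hw.le]
  rw [mulOp_apply, hk, map_smul, norm_smul, h3] at h1
  rw [mul_pow, hn] at h2
  set q := (1 - ‖(w : ℂ)‖ ^ 2)⁻¹
  have hq : 0 < q := inv_pos.2 hw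
  refine le_of_sq_le_sq ?_ (by positivity)
  have h4 : q ^ 2 * ‖Φ w x‖ ^ 2 ≤ q ^ 2 * (‖mulOp Φ hΦ‖ * ‖x‖) ^ 2 := by
    calc q ^ 2 * ‖Φ w x‖ ^ 2 = (q * ‖Φ w x‖) ^ 2 := by ring
      _ ≤ q * (‖mulOp Φ hΦ‖ ^ 2 * (q * ‖x‖ ^ 2)) := h1.trans (by gcongr)
      _ = _ := by ring
  exact le_of_mul_le_mul_left h4 (by positivity)

end NormOfToeplitz

/-! ### Strong radial limits and part (i). -/

section BoundaryValues

variable {E : Type*} [NormedAddCommGroup E] [InnerProductSpace ℂ E]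

theorem eventually_norm_radial_le {Φ : ℂ → E →L[ℂ] E} (hΦ : IsHInfty Φ)
    (t : AddCircle (2 * Real.pi)) :
    ∀ᶠ r : ℝ in 𝓝[<] 1, ‖Φ (r * toCircle t)‖ ≤ hInftyNorm Φ := by
  filter_upwards [Ioo_mem_nhdsLT (show (0 : ℝ) < 1 by norm_num)] with r hr
  exact hΦ.norm_le (radialPt r hr.1.le hr.2 t)

theorem IsRadialLimit.norm_le {Φ : ℂ → E →L[ℂ] E} (hΦ : IsHInfty Φ)
    {t : AddCircle (2 * Real.pi)} {A : E →L[ℂ] E} (hA : IsRadialLimit Φ (toCircle t) A) :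
    ‖A‖ ≤ hInftyNorm Φ := by
  refine ContinuousLinearMap.opNorm_le_bound _ (hInftyNorm_nonneg Φ) fun x => ?_
  refine le_of_tendsto (hA x).norm ?_
  filter_upwards [eventually_norm_radial_le hΦ t] with r hr
  exact ContinuousLinearMap.le_of_opNorm_le _ hr x

/-- Strong convergence of a uniformly bounded family allows the vector to move. With `v r = f (rζ)`
this identifies the boundary function of `M_Φ f`. -/
theorem IsRadialLimit.tendsto_apply {Φ : ℂ → E →L[ℂ] E} (hΦ : IsHInfty Φ)
    {t : AddCircle (2 * Real.pi)} {A : E →L[ℂ] E} (hA : IsRadialLimit Φ (toCircle t) A)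
    {v : ℝ → E} {x : E} (hv : Tendsto v (𝓝[<] 1) (𝓝 x)) :
    Tendsto (fun r : ℝ => Φ (r * toCircle t) (v r)) (𝓝[<] 1) (𝓝 (A x)) := by
  have h1 : Tendsto (fun r : ℝ => Φ (r * toCircle t) (v r - x)) (𝓝[<] 1) (𝓝 0) := by
    have h2 : Tendsto (fun r => hInftyNorm Φ * ‖v r - x‖) (𝓝[<] 1) (𝓝 0) := by
      have := ((hv.sub_const x).norm).const_mul (hInftyNorm Φ)
      simpa using this
    refine squeeze_zero_norm' ?_ h2
    filter_upwards [eventually_norm_radial_le hΦ t] with r hr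
    exact ContinuousLinearMap.le_of_opNorm_le _ hr _
  simpa using h1.add (hA x)

theorem norm_sq_eq_integral (g : Lp E 2 circleMeasure) :
    ‖g‖ ^ 2 = ∫ t, ‖g t‖ ^ 2 ∂circleMeasure := by
  have h := L2.inner_def (𝕜 := ℂ) g g
  simp only [inner_self_eq_norm_sq_to_K] at h
  have h2 : ∫ t, ((‖g t‖ : ℂ)) ^ 2 ∂circleMeasure
      = ((∫ t, ‖g t‖ ^ 2 ∂circleMeasure : ℝ) : ℂ) := by
    rw [← integral_complex_ofReal]
    push_cast
    rfl
  refine Complex.ofReal_injective (Eq.trans ?_ (h.trans h2))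
  push_cast
  rfl

variable [CompleteSpace E]

/-- If the radial limits of `Φ` exist on a dense sequence of vectors, then they exist in the strong
operator topology. -/
theorem exists_isRadialLimit_of_dense {Φ : ℂ → E →L[ℂ] E} (hΦ : IsHInfty Φ)
    {t : AddCircle (2 * Real.pi)} {x : ℕ → E} (hx : DenseRange x)
    (h : ∀ k, ∃ y, Tendsto (fun r : ℝ => Φ (r * toCircle t) (x k)) (𝓝[<] 1) (𝓝 y)) :
    ∃ A : E →L[ℂ] E, IsRadialLimit Φ (toCircle t) A := by
  have hC := hInftyNorm_nonneg Φ
  have hall : ∀ v : E, ∃ y,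
      Tendsto (fun r : ℝ => Φ (r * toCircle t) v) (𝓝[<] 1) (𝓝 y) := by
    intro v
    refine cauchy_map_iff_exists_tendsto.1 (Metric.cauchy_iff.2 ⟨inferInstance, fun ε hε => ?_⟩)
    -- An `ε / 3` argument; the `+ 1` covers `hInftyNorm Φ = 0`.
    obtain ⟨k, hk⟩ := hx.exists_dist_lt v
      (show 0 < ε / (3 * (hInftyNorm Φ + 1)) by positivity)
    obtain ⟨s, hs, hs'⟩ := (Metric.cauchy_iff.1 (cauchy_map_iff_exists_tendsto.2 (h k))).2
      (ε / 3) (by positivity)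
    have hclose : ∀ r : ℝ, ‖Φ (r * toCircle t)‖ ≤ hInftyNorm Φ →
        dist (Φ (r * toCircle t) v) (Φ (r * toCircle t) (x k)) < ε / 3 := by
      intro r hr
      rw [dist_eq_norm, ← map_sub]
      rw [dist_eq_norm, lt_div_iff₀ (by positivity)] at hk
      have := ContinuousLinearMap.le_of_opNorm_le _ hr (v - x k)
      nlinarith [norm_nonneg (v - x k)]
    refine ⟨(fun r : ℝ => Φ (r * toCircle t) v) '' ({r | Φ (r * toCircle t) (x k) ∈ s} ∩
      {r | ‖Φ (r * toCircle t)‖ ≤ hInftyNorm Φ}), image_mem_map (inter_mem hs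
        (eventually_norm_radial_le hΦ t)), ?_⟩
    rintro _ ⟨r, ⟨hr1, hr2⟩, rfl⟩ _ ⟨r', ⟨hr1', hr2'⟩, rfl⟩
    have h1 := hclose r hr2
    have h2 := hclose r' hr2'
    rw [dist_comm] at h2
    have h3 := hs' _ hr1 _ hr1'
    have h4 := dist_triangle4 (Φ (r * toCircle t) v) (Φ (r * toCircle t) (x k))
      (Φ (r' * toCircle t) (x k)) (Φ (r' * toCircle t) v)
    linarith
  choose L hL using hall
  refine ⟨LinearMap.mkContinuous
    { toFun := L
      map_add' := fun v w => tendsto_nhds_unique (hL (v + w)) (by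
        simpa using (hL v).add (hL w))
      map_smul' := fun c v => tendsto_nhds_unique (hL (c • v)) (by
        simpa using (hL v).const_smul c) } (hInftyNorm Φ) fun v => ?_, hL⟩
  refine le_of_tendsto (hL v).norm ?_
  filter_upwards [eventually_norm_radial_le hΦ t] with r hr
  exact ContinuousLinearMap.le_of_opNorm_le _ hr v

/-- Radial limits of bounded analytic operator functions exist almost everywhere in the strong
operator topology. -/
theorem ae_exists_isRadialLimit [TopologicalSpace.SeparableSpace E] {Φ : ℂ → E →L[ℂ] E}
    (hΦ : IsHInfty Φ) :
    ∀ᵐ t ∂circleMeasure, ∃ A : E →L[ℂ] E, IsRadialLimit Φ (toCircle t) A := by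
  have h : ∀ k : ℕ, ∀ᵐ t ∂circleMeasure, ∃ y, Tendsto
      (fun r : ℝ => Φ (r * toCircle t) (TopologicalSpace.denseSeq E k)) (𝓝[<] 1) (𝓝 y) := by
    intro k
    obtain ⟨c, hc, -⟩ := exists_const (TopologicalSpace.denseSeq E k)
    filter_upwards [ae_tendsto_radial (mulOp Φ hΦ c)
      (F := fun w => Φ w (TopologicalSpace.denseSeq E k))
      (fun z => by rw [mulOp_apply, hc])] with t ht
    exact ⟨_, ht⟩
  filter_upwards [ae_all_iff.2 h] with t ht
  exact exists_isRadialLimit_of_dense hΦ (TopologicalSpace.denseRange_denseSeq E) ht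

/-- The boundary function of a nonzero function in the Hardy space vanishes almost nowhere. -/
theorem ae_boundary_ne_zero {f : HardySpace E} (hf : f ≠ 0) :
    ∀ᵐ t ∂circleMeasure, boundary f t ≠ 0 := by
  obtain ⟨z₀, hz₀⟩ : ∃ z : 𝔻, f z ≠ 0 := by
    by_contra! h
    exact hf (Subtype.ext (funext h))
  set F : ℂ → E := fun w => ∑' n, w ^ n • coeff f n
  have hF : ∀ z : 𝔻, F z = f z := fun z => (hasSum_coeff f z).tsum_eq
  -- Pairing with `f z₀` reduces to a scalar function that is nonzero at `z₀` and has radial limit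
  -- zero wherever `boundary f` vanishes.
  have hd : DifferentiableOn ℂ (fun w => inner ℂ (f z₀) (F w)) (Metric.ball 0 1) :=
    (innerSL ℂ (f z₀)).differentiable.comp_differentiableOn (differentiableOn_extension f)
  have hbound : ∀ r : ℝ, 0 ≤ r → r < 1 →
      ∫ t, ‖inner ℂ (f z₀) (F (r * toCircle t))‖ ^ 2 ∂circleMeasure ≤ ‖f z₀‖ ^ 2 * ‖f‖ ^ 2 := by
    intro r hr hr1
    have hs := hasSum_sq_radial (hasSum_coeff f) hr hr1
    calc ∫ t, ‖inner ℂ (f z₀) (F (r * toCircle t))‖ ^ 2 ∂circleMeasure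
        ≤ ∫ t, ‖f z₀‖ ^ 2 * ‖f (radialPt r hr hr1 t)‖ ^ 2 ∂circleMeasure := by
          refine integral_mono
            (integrable_of_continuous ((continuous_comp_circle hd.continuousOn hr hr1).norm.pow 2))
            (integrable_of_continuous (continuous_const.mul
              ((continuous_radial (hasSum_coeff f) hr hr1).norm.pow 2))) fun t => ?_
          have h1 : F (r * toCircle t) = f (radialPt r hr hr1 t) := hF (radialPt r hr hr1 t)
          simp only [h1]
          rw [← mul_pow]
          gcongr
          exact norm_inner_le_norm _ _
      _ = ‖f z₀‖ ^ 2 * ∑' n, ‖(r : ℂ) ^ n • coeff f n‖ ^ 2 := by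
          rw [integral_const_mul, hs.tsum_eq]
      _ ≤ ‖f z₀‖ ^ 2 * ‖f‖ ^ 2 := by
          rw [norm_sq_eq]
          refine mul_le_mul_of_nonneg_left ?_ (sq_nonneg _)
          refine hs.summable.tsum_le_tsum (fun n => ?_) (summable_coeff f)
          rw [norm_smul, norm_pow, Complex.norm_real, Real.norm_of_nonneg hr]
          gcongr
          exact mul_le_of_le_one_left (norm_nonneg _) (pow_le_one₀ hr hr1.le)
  have hne : inner ℂ (f z₀) (F z₀) ≠ 0 := by
    rw [hF]
    exact inner_self_ne_zero.2 hz₀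
  filter_upwards [ae_tendsto_radial f hF,
    ae_not_tendsto_zero hd (by simpa using z₀.norm_lt_one) hne hbound] with t h1 h2 h3
  refine h2 ?_
  rw [h3] at h1
  have := (innerSL ℂ (f z₀)).continuous.tendsto 0 |>.comp h1
  rw [map_zero] at this
  exact this

/-- Norm attainment is equality in an integrated pointwise inequality, hence equality almost
everywhere; dividing by `‖boundary f t‖ ≠ 0` leaves the operator norm. -/
theorem ae_norm_eq_of_normAttaining [TopologicalSpace.SeparableSpace E] {Φ : ℂ → E →L[ℂ] E}
    (hΦ : IsHInfty Φ) (h : NormAttaining (mulOp Φ hΦ)) :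
    ∀ᵐ t ∂circleMeasure, ∃ A : E →L[ℂ] E,
      IsRadialLimit Φ (toCircle t) A ∧ ‖A‖ = hInftyNorm Φ := by
  obtain ⟨f, hf, hnorm⟩ := h
  rw [norm_mulOp] at hnorm
  set C := hInftyNorm Φ
  set F : ℂ → E := fun w => ∑' n, w ^ n • coeff f n
  have hF : ∀ z : 𝔻, F z = f z := fun z => (hasSum_coeff f z).tsum_eq
  set g := boundary (mulOp Φ hΦ f)
  have hlim : ∀ᵐ t ∂circleMeasure, ∃ A : E →L[ℂ] E, IsRadialLimit Φ (toCircle t) A ∧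
      g t = A (boundary f t) := by
    filter_upwards [ae_exists_isRadialLimit hΦ, ae_tendsto_radial f hF,
      ae_tendsto_radial (mulOp Φ hΦ f) (F := fun w => Φ w (F w))
        (fun z => by rw [mulOp_apply, hF])] with t ⟨A, hA⟩ h1 h2
    exact ⟨A, hA, tendsto_nhds_unique h2 (hA.tendsto_apply hΦ h1)⟩
  have hle : ∀ᵐ t ∂circleMeasure, 0 ≤ C ^ 2 * ‖boundary f t‖ ^ 2 - ‖g t‖ ^ 2 := by
    filter_upwards [hlim] with t ⟨A, hA, hgt⟩
    rw [sub_nonneg, hgt, ← mul_pow]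
    gcongr
    exact ContinuousLinearMap.le_of_opNorm_le _ (hA.norm_le hΦ) _
  have hint : ∀ k : Lp E 2 circleMeasure, Integrable (fun t => ‖k t‖ ^ 2) circleMeasure :=
    fun k => (Lp.memLp k).integrable_norm_pow two_ne_zero
  have hzero : ∫ t, (C ^ 2 * ‖boundary f t‖ ^ 2 - ‖g t‖ ^ 2) ∂circleMeasure = 0 := by
    rw [integral_sub ((hint _).const_mul _) (hint _), integral_const_mul, ← norm_sq_eq_integral,
      ← norm_sq_eq_integral, norm_boundary, norm_boundary, hnorm]
    ring
  have hae := (integral_eq_zero_iff_of_nonneg_ae hle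
    (((hint _).const_mul _).sub (hint _))).1 hzero
  filter_upwards [hlim, hae, ae_boundary_ne_zero hf] with t ⟨A, hA, hgt⟩ h0 hne
  refine ⟨A, hA, le_antisymm (hA.norm_le hΦ) ?_⟩
  have h1 : (C * ‖boundary f t‖) ^ 2 = ‖A (boundary f t)‖ ^ 2 := by
    rw [← hgt, mul_pow]
    exact sub_eq_zero.1 h0
  have h2 := (sq_eq_sq₀ (mul_nonneg (hInftyNorm_nonneg Φ) (norm_nonneg _)) (norm_nonneg _)).1 h1
  have h3 := A.le_opNorm (boundary f t)
  rw [← h2] at h3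
  exact le_of_mul_le_mul_right h3 (norm_pos_iff.2 hne)

end BoundaryValues

/-! ### Scalar symbols and part (ii). -/

section Scalar

theorem IsHInfty.const_smul {E : Type*} [NormedAddCommGroup E] [InnerProductSpace ℂ E]
    {Φ : ℂ → E →L[ℂ] E} (hΦ : IsHInfty Φ) (c : ℂ) : IsHInfty fun z => c • Φ z := by
  obtain ⟨C, hC⟩ := hΦ.bounded
  refine ⟨hΦ.differentiableOn.const_smul c, ‖c‖ * C, fun z hz => ?_⟩
  rw [norm_smul]
  exact mul_le_mul_of_nonneg_left (hC z hz) (norm_nonneg _)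

/-- An operator on `ℂ` is multiplication by `A 1`. This is where dimension one enters: the norm of a
boundary value determines whether it is a multiple of an isometry. -/
theorem norm_apply_eq (A : ℂ →L[ℂ] ℂ) (x : ℂ) : ‖A x‖ = ‖A‖ * ‖x‖ := by
  have h : ∀ y, ‖A y‖ = ‖A 1‖ * ‖y‖ := fun y => by
    have : A y = y * A 1 := by rw [← smul_eq_mul, ← map_smul, smul_eq_mul, mul_one]
    rw [this, norm_mul, mul_comm]
  have h1 : ‖A‖ = ‖A 1‖ := le_antisymm
    (A.opNorm_le_bound (norm_nonneg _) fun y => (h y).le) (by simpa using A.le_opNorm 1)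
  rw [h1, h]

theorem normAttaining_iff_isInner {Φ : ℂ → ℂ →L[ℂ] ℂ} (hΦ : IsHInfty Φ)
    (hne : ∃ z ∈ Metric.ball (0 : ℂ) 1, Φ z ≠ 0) :
    NormAttaining (mulOp Φ hΦ) ↔ IsInner fun z => ((hInftyNorm Φ : ℂ)⁻¹) • Φ z := by
  have hpos : 0 < hInftyNorm Φ := by
    obtain ⟨z, hz, hz0⟩ := hne
    exact (norm_pos_iff.2 hz0).trans_le
      (hΦ.norm_le (Complex.UnitDisc.mk z (by simpa using hz)))
  constructor
  · intro h
    refine ⟨hΦ.const_smul _, ?_⟩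
    filter_upwards [ae_norm_eq_of_normAttaining hΦ h] with t ⟨A, hA, hnorm⟩
    refine ⟨((hInftyNorm Φ : ℂ)⁻¹) • A, fun x => (hA x).const_smul (hInftyNorm Φ : ℂ)⁻¹, ?_⟩
    refine AddMonoidHomClass.isometry_of_norm _ fun x => ?_
    rw [smul_apply, norm_smul, norm_apply_eq, hnorm, norm_inv,
      Complex.norm_real, Real.norm_of_nonneg hpos.le, inv_mul_cancel_left₀ hpos.ne']
  · rintro ⟨-, h⟩
    -- The constant `1` is extremal: the boundary function of its image has modulus `hInftyNorm Φ`
    -- almost everywhere, on a circle of measure one.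
    obtain ⟨k, hk, hkn⟩ := exists_const (1 : ℂ)
    rw [norm_one] at hkn
    refine ⟨k, fun h0 => by simp [h0] at hkn, ?_⟩
    rw [norm_mulOp, hkn, mul_one, ← norm_boundary]
    refine (sq_eq_sq₀ (norm_nonneg _) hpos.le).1 ?_
    rw [norm_sq_eq_integral]
    have hae : ∀ᵐ t ∂circleMeasure,
        ‖boundary (mulOp Φ hΦ k) t‖ ^ 2 = hInftyNorm Φ ^ 2 := by
      filter_upwards [h, ae_tendsto_radial (mulOp Φ hΦ k) (F := fun w => Φ w 1)
        (fun z => by rw [mulOp_apply, hk])] with t ⟨A, hA, hiso⟩ ht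
      have h1 := tendsto_nhds_unique (ht.const_smul ((hInftyNorm Φ : ℂ)⁻¹)) (hA 1)
      have h2 : ‖A 1‖ = 1 := by
        rw [hiso.norm_map_of_map_zero (map_zero A), norm_one]
      rw [← h1, norm_smul, norm_inv, Complex.norm_real, Real.norm_of_nonneg hpos.le,
        inv_mul_eq_one₀ hpos.ne'] at h2
      rw [h2]
    rw [integral_congr_ae hae]
    simp

end Scalar

end

end HardyToeplitz

theorem theorem4p4 :
    (∀ (E : Type*) [NormedAddCommGroup E] [InnerProductSpace ℂ E] [CompleteSpace E]
        [TopologicalSpace.SeparableSpace E]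
        (Φ : ℂ → E →L[ℂ] E) (hΦ : HardyToeplitz.IsHInfty Φ),
        HardyToeplitz.NormAttaining (HardyToeplitz.mulOp Φ hΦ) →
          ∀ᵐ t ∂HardyToeplitz.circleMeasure, ∃ A : E →L[ℂ] E,
            HardyToeplitz.IsRadialLimit Φ (AddCircle.toCircle t) A ∧
              ‖A‖ = HardyToeplitz.hInftyNorm Φ) ∧
    (∀ (Φ : ℂ → ℂ →L[ℂ] ℂ) (hΦ : HardyToeplitz.IsHInfty Φ),
        (∃ z ∈ Metric.ball (0 : ℂ) 1, Φ z ≠ 0) →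
          (HardyToeplitz.NormAttaining (HardyToeplitz.mulOp Φ hΦ) ↔
            HardyToeplitz.IsInner
              (fun z => ((HardyToeplitz.hInftyNorm Φ : ℂ)⁻¹) • Φ z))) :=
  ⟨fun _ _ _ _ _ _ hΦ h => HardyToeplitz.ae_norm_eq_of_normAttaining hΦ h,
    fun _ hΦ hne => HardyToeplitz.normAttaining_iff_isInner hΦ hne⟩
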